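/- Let $E$ be an elliptic curve over $\mathbb{R}$, and give $E(\mathbb{C})$ its usual (analytic) topology. Let $E(\mathbb{C})^-$ denote the subgroup of points $P \in E(\mathbb{C})$ whose complex conjugate is $-P$, let $E(\mathbb{C})^-_0$ be the connected component of the identity in $E(\mathbb{C})^-$, and let $H_1(E(\mathbb{C}),\mathbb{Z})^-$ be the subgroup of those classes in the first singular homology group $H_1(E(\mathbb{C}),\mathbb{Z})$ that are negated by the action of complex conjugation. Then the homomorphism $H_1(E(\mathbb{C})^-_0,\mathbb{Z}) \to H_1(E(\mathbb{C}),\mathbb{Z})$ induced by the inclusion $E(\mathbb{C})^-_0 \subseteq E(\mathbb{C})$ takes values in $H_1(E(\mathbb{C}),\mathbb{Z})^-$, and the resulting natural map $$H_1(E(\mathbb{C})^-_0,\mathbb{Z}) \longrightarrow H_1(E(\mathbb{C}),\mathbb{Z})^-$$ is an isomorphism. -/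

import Mathlib

open scoped LinearAlgebra.Projectivization

/-! ### The complex points of an elliptic curve over the reals, with their analytic topology -/

/-- The group `E(ℂ)` of complex points of a Weierstrass curve `E` over `ℝ`:
the affine solutions of the equation together with the point at infinity `0 = [0 : 1 : 0]`. -/
noncomputable abbrev ComplexPoints (E : WeierstrassCurve ℝ) : Type :=
  (E.baseChange ℂ).toAffine.Point

/-- The usual topology on the complex projective plane `ℙ²(ℂ)`, as the quotient of `ℂ³ ∖ {0}`. -/
noncomputable instance projectivePlaneTopology : TopologicalSpace (ℙ ℂ (Fin 3 → ℂ)) :=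
  TopologicalSpace.coinduced (Projectivization.mk' ℂ) inferInstance

/-- The embedding of `E(ℂ)` in `ℙ²(ℂ)`, given by `(x, y) ↦ [x : y : 1]` and `0 ↦ [0 : 1 : 0]`. -/
noncomputable def toProjectivePlane (E : WeierstrassCurve ℝ) :
    ComplexPoints E → ℙ ℂ (Fin 3 → ℂ)
  | .zero => Projectivization.mk ℂ ![0, 1, 0] (fun h => one_ne_zero (congrFun h 1))
  | .some x y _ => Projectivization.mk ℂ ![x, y, 1] (fun h => one_ne_zero (congrFun h 2))

/-- The analytic topology on `E(ℂ)`: the subspace topology from `ℙ²(ℂ)`. -/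
noncomputable instance complexPointsTopology (E : WeierstrassCurve ℝ) : TopologicalSpace (ComplexPoints E) :=
  TopologicalSpace.induced (toProjectivePlane E) inferInstance

/-! ### Complex conjugation -/

/-- Complex conjugation on `E(ℂ)`, the group homomorphism `(x, y) ↦ (x̄, ȳ)`. -/
noncomputable def complexConj (E : WeierstrassCurve ℝ) : ComplexPoints E →+ ComplexPoints E :=
  WeierstrassCurve.Affine.Point.map (W' := E) (Complex.conjAe : ℂ →ₐ[ℝ] ℂ)

/-- Complex conjugation of the coordinates on `ℙ²(ℂ)`; only used to prove that
complex conjugation on `E(ℂ)` is continuous. -/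
noncomputable def projectiveConj : ℙ ℂ (Fin 3 → ℂ) → ℙ ℂ (Fin 3 → ℂ) :=
  Projectivization.lift
    (fun v => Projectivization.mk ℂ (star v.1) (star_ne_zero.mpr v.2))
    (fun a b t h => by
      refine (Projectivization.mk_eq_mk_iff' ℂ _ _ _ _).mpr ⟨star t, ?_⟩
      rw [h, star_smul])

theorem continuous_projectiveConj : Continuous projectiveConj := by
  refine continuous_coinduced_dom.mpr ?_
  have h : Continuous (fun v : {v : Fin 3 → ℂ // v ≠ 0} =>
      (⟨star v.1, star_ne_zero.mpr v.2⟩ : {v : Fin 3 → ℂ // v ≠ 0})) :=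
    (continuous_star.comp continuous_subtype_val).subtype_mk _
  have hq : Continuous (Projectivization.mk' ℂ : {v : Fin 3 → ℂ // v ≠ 0} → _) :=
    continuous_coinduced_rng
  exact hq.comp h

theorem toProjectivePlane_complexConj (E : WeierstrassCurve ℝ) (P : ComplexPoints E) :
    toProjectivePlane E (complexConj E P) = projectiveConj (toProjectivePlane E P) := by
  have h : ∀ (a b c : ℂ), star ![a, b, c] = ![star a, star b, star c] := by
    intro a b c
    funext i
    fin_cases i <;> rfl
  rcases P with _ | ⟨x, y, hxy⟩
  · change Projectivization.mk ℂ ![0, 1, 0] _ = Projectivization.mk ℂ (star ![0, 1, 0]) _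
    congr 1
    rw [h, star_zero, star_one]
  · change Projectivization.mk ℂ ![star x, star y, 1] _ = Projectivization.mk ℂ (star ![x, y, 1]) _
    congr 1
    rw [h, star_one]

theorem continuous_complexConj (E : WeierstrassCurve ℝ) : Continuous (complexConj E) := by
  refine continuous_induced_rng.mpr ?_
  have h : toProjectivePlane E ∘ complexConj E = projectiveConj ∘ toProjectivePlane E :=
    funext (toProjectivePlane_complexConj E)
  rw [h]
  exact continuous_projectiveConj.comp continuous_induced_dom

/-- The subgroup `E(ℂ)⁻` of points `P` of `E(ℂ)` whose complex conjugate is `-P`. -/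
noncomputable def antiInvariantPoints (E : WeierstrassCurve ℝ) : AddSubgroup (ComplexPoints E) where
  carrier := {P | complexConj E P = -P}
  zero_mem' := by simp
  add_mem' := by
    intro P Q hP hQ
    simp only [Set.mem_ofPred_eq] at hP hQ ⊢
    rw [map_add, hP, hQ, neg_add]
  neg_mem' := by
    intro P hP
    simp only [Set.mem_ofPred_eq] at hP ⊢
    rw [map_neg, hP]

/-- The connected component `E(ℂ)⁻₀` of the identity in `E(ℂ)⁻`, with the subspace topology. -/
noncomputable abbrev AntiInvariantComponent (E : WeierstrassCurve ℝ) : Type :=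
  connectedComponent (0 : antiInvariantPoints E)

/-! ### First integral singular homology -/

/-- The first singular homology group `H₁(X, ℤ)`. -/
noncomputable abbrev H1 (X : Type) [TopologicalSpace X] : ModuleCat.{0} ℤ :=
  ((AlgebraicTopology.singularHomologyFunctor (ModuleCat.{0} ℤ) 1).obj (ModuleCat.of ℤ ℤ)).obj
    (TopCat.of X)

/-- The group homomorphism `f_* : H₁(X, ℤ) → H₁(Y, ℤ)` induced by a continuous map `f : X → Y`. -/
noncomputable def H1map {X Y : Type} [TopologicalSpace X] [TopologicalSpace Y] (f : C(X, Y)) :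
    H1 X →+ H1 Y :=
  (((AlgebraicTopology.singularHomologyFunctor (ModuleCat.{0} ℤ) 1).obj (ModuleCat.of ℤ ℤ)).map
    (TopCat.ofHom f)).hom.toAddMonoidHom

/-- The subgroup `H₁(E(ℂ), ℤ)⁻` of homology classes that are negated by complex conjugation. -/
noncomputable def H1minus (E : WeierstrassCurve ℝ) : AddSubgroup (H1 (ComplexPoints E)) where
  carrier := {c | H1map ⟨complexConj E, continuous_complexConj E⟩ c = -c}
  zero_mem' := by simp
  add_mem' := by
    intro a b ha hb
    simp only [Set.mem_ofPred_eq] at ha hb ⊢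
    rw [map_add, ha, hb, neg_add]
  neg_mem' := by
    intro a ha
    simp only [Set.mem_ofPred_eq] at ha ⊢
    rw [map_neg, ha]

/-- The inclusion `E(ℂ)⁻₀ ⊆ E(ℂ)` as a continuous map. -/
noncomputable def antiInvariantComponentInclusion (E : WeierstrassCurve ℝ) :
    C(AntiInvariantComponent E, ComplexPoints E) :=
  ⟨fun P => P.1.1, continuous_subtype_val.comp continuous_subtype_val⟩

/-! Uniformization reduces the statement to linear algebra. There is a continuous, open, surjective
homomorphism `p : ℂ →+ E(ℂ)` with discrete kernel `Λ`, hence a covering map. For any such quotient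
of a real vector space, sending a period `l` to the class of the image of the segment from `0` to
`l` identifies `Λ` with `H₁` (`periodEquiv`), and maps that lift to linear maps act on `H₁` through
those linear maps (`H1map_periodEquiv`).

Conjugation lifts to a real-linear `T` on `ℂ` (`exists_linear_lift`). Put `V⁻ = ker (T + 1)`. Then
`p` maps `V⁻` onto `E(ℂ)⁻₀` and is a covering with kernel `Λ ∩ V⁻`
(`isVectorCovering_antiInvariantComponent`). So the map on `H₁` is the inclusion of `Λ ∩ V⁻` in `Λ`,
whose image is the part of `Λ` where `T` is `-1`, that is, `H₁(E(ℂ), ℤ)⁻`.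

The uniformization uses no elliptic functions. Near an affine point not of order two, a primitive of
the invariant differential `dx / (2y + a₁x + a₃)` is a local coordinate, and invariance under
translation makes its inverse, moved to the origin, additive near `0` (`exists_local_hom`). Repeated
halving extends it to a homomorphism on `ℂ`. Its image is an open subgroup other than `0`, hence
everything (`eq_top_of_isOpen`), because the `x`-line is connected. -/

section SingularHomology

open CategoryTheory Limits AlgebraicTopology Simplicial

/-! ### Singular chains and first homology, concretely -/

namespace SingularChain

variable {X Y : Type} [TopologicalSpace X] [TopologicalSpace Y]

/-- The singular chain complex of `X` with integral coefficients. -/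
noncomputable abbrev complex (X : Type) [TopologicalSpace X] : ChainComplex (ModuleCat.{0} ℤ) ℕ :=
  ((singularChainComplexFunctor (ModuleCat.{0} ℤ)).obj (ModuleCat.of ℤ ℤ)).obj (TopCat.of X)

/-- The chain map induced by a continuous map. -/
noncomputable abbrev map (f : C(X, Y)) : complex X ⟶ complex Y :=
  ((singularChainComplexFunctor (ModuleCat.{0} ℤ)).obj (ModuleCat.of ℤ ℤ)).map (TopCat.ofHom f)

/-- The simplex of the singular set given by a continuous map on the standard simplex. -/
noncomputable def toSimplex {n : ℕ} (σ : C(stdSimplex ℝ (Fin (n + 1)), X)) :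
    (TopCat.toSSet.obj (TopCat.of X)) _⦋n⦌ :=
  (TopCat.toSSetObjEquiv (TopCat.of X) (.op ⦋n⦌)).symm σ

/-- A singular simplex, as a singular chain. -/
noncomputable def single {n : ℕ} (σ : C(stdSimplex ℝ (Fin (n + 1)), X)) : (complex X).X n :=
  (SSet.ιChainComplex (R := ModuleCat.of ℤ ℤ) (TopCat.toSSet.obj (TopCat.of X)) (toSimplex σ)).hom
    (1 : ℤ)

/-- The `i`-th face of the standard simplex. -/
noncomputable def face {n : ℕ} (i : Fin (n + 2)) :
    C(stdSimplex ℝ (Fin (n + 1)), stdSimplex ℝ (Fin (n + 2))) :=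
  ⟨stdSimplex.map (Fin.succAbove i), stdSimplex.continuous_map _⟩

theorem delta_toSimplex {n : ℕ} (σ : C(stdSimplex ℝ (Fin (n + 2)), X)) (i : Fin (n + 2)) :
    (TopCat.toSSet.obj (TopCat.of X)).δ i (toSimplex σ) = toSimplex (σ.comp (face i)) := by
  rfl

theorem d_single_one (σ : C(stdSimplex ℝ (Fin 2), X)) :
    ((complex X).d 1 0).hom (single σ) =
      single (n := 0) (σ.comp (face 0)) - single (n := 0) (σ.comp (face 1)) := by
  have h := (SSet.ιChainComplex_d (TopCat.toSSet.obj (TopCat.of X)) (ModuleCat.of ℤ ℤ)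
    (toSimplex σ)).trans (Fin.sum_univ_two _)
  simp only [delta_toSimplex, Fin.val_zero, Fin.val_one, pow_zero, pow_one,
    one_smul, neg_smul, ← sub_eq_add_neg] at h
  exact congrArg (fun f => f.hom (1 : ℤ)) h

theorem d_single_two (σ : C(stdSimplex ℝ (Fin 3), X)) :
    ((complex X).d 2 1).hom (single σ) =
      single (n := 1) (σ.comp (face 0)) - single (n := 1) (σ.comp (face 1)) +
        single (n := 1) (σ.comp (face 2)) := by
  have h := (SSet.ιChainComplex_d (TopCat.toSSet.obj (TopCat.of X)) (ModuleCat.of ℤ ℤ)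
    (toSimplex σ)).trans (Fin.sum_univ_three _)
  simp only [delta_toSimplex, Fin.val_zero, Fin.val_one, Fin.val_two, pow_zero,
    pow_one, one_smul, neg_smul, ← sub_eq_add_neg, even_two, Even.neg_pow, one_pow] at h
  exact congrArg (fun f => f.hom (1 : ℤ)) h

theorem map_single {n : ℕ} (f : C(X, Y)) (σ : C(stdSimplex ℝ (Fin (n + 1)), X)) :
    ((map f).f n).hom (single σ) = single (f.comp σ) :=
  congrArg (fun g => g.hom (1 : ℤ)) (SSet.ι_chainComplexMap_f
    (X := TopCat.toSSet.obj (TopCat.of X)) (Y := TopCat.toSSet.obj (TopCat.of Y))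
    (TopCat.toSSet.map (TopCat.ofHom f)) (ModuleCat.of ℤ ℤ) (toSimplex σ))

/-- Two homomorphisms on singular chains that agree on simplices are equal. -/
theorem hom_ext {n : ℕ} {M : ModuleCat.{0} ℤ} {φ ψ : (complex X).X n ⟶ M}
    (h : ∀ σ : C(stdSimplex ℝ (Fin (n + 1)), X), φ.hom (single σ) = ψ.hom (single σ)) : φ = ψ := by
  refine SSet.chainComplex_hom_ext fun x => ?_
  obtain ⟨σ, rfl⟩ := (TopCat.toSSetObjEquiv (TopCat.of X) (.op ⦋n⦌)).symm.surjective x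
  refine ModuleCat.hom_ext (LinearMap.ext_ring ?_)
  exact h σ

/-- The homomorphism on singular chains with prescribed values on simplices. -/
noncomputable def desc {n : ℕ} {M : Type} [AddCommGroup M]
    (φ : C(stdSimplex ℝ (Fin (n + 1)), X) → M) : (complex X).X n ⟶ ModuleCat.of ℤ M :=
  Sigma.desc (f := fun _ : (TopCat.toSSet.obj (TopCat.of X)) _⦋n⦌ => ModuleCat.of ℤ ℤ)
    fun x => ModuleCat.ofHom
      (LinearMap.toSpanSingleton ℤ M (φ (TopCat.toSSetObjEquiv (TopCat.of X) (.op ⦋n⦌) x)))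

theorem desc_single {n : ℕ} {M : Type} [AddCommGroup M]
    (φ : C(stdSimplex ℝ (Fin (n + 1)), X) → M) (σ : C(stdSimplex ℝ (Fin (n + 1)), X)) :
    (desc φ).hom (single σ) = φ σ := by
  have h := congrArg (fun f => f.hom (1 : ℤ)) (Sigma.ι_desc (C := ModuleCat.{0} ℤ)
    (f := fun _ : (TopCat.toSSet.obj (TopCat.of X)) _⦋n⦌ => ModuleCat.of ℤ ℤ)
    (fun x => ModuleCat.ofHom (LinearMap.toSpanSingleton ℤ M
      (φ (TopCat.toSSetObjEquiv (TopCat.of X) (.op ⦋n⦌) x)))) (toSimplex σ))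
  refine Eq.trans h ?_
  simp [toSimplex]

/-- The singular chains are generated by the simplices. -/
theorem span_single (n : ℕ) :
    Submodule.span ℤ (Set.range (single (X := X) (n := n))) = ⊤ := by
  set S := Submodule.span ℤ (Set.range (single (X := X) (n := n)))
  -- The quotient map by the span kills every simplex, so it is zero and the span is everything.
  have h : @ModuleCat.ofHom ℤ _ ((complex X).X n) ((complex X).X n ⧸ S) _ _ _
        (Submodule.Quotient.module S) S.mkQ =
      (0 : (complex X).X n ⟶ @ModuleCat.of ℤ _ ((complex X).X n ⧸ S) _ (Submodule.Quotient.module S)) :=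
    hom_ext fun σ => (Submodule.Quotient.mk_eq_zero S).mpr (Submodule.subset_span ⟨σ, rfl⟩)
  refine (Submodule.eq_top_iff').mpr fun x => ?_
  exact (Submodule.Quotient.mk_eq_zero S).mp (congrArg (fun f => f.hom x) h)

theorem induction {n : ℕ} {P : (complex X).X n → Prop} (c : (complex X).X n)
    (single : ∀ σ, P (single σ)) (zero : P 0) (add : ∀ a b, P a → P b → P (a + b))
    (neg : ∀ a, P a → P (-a)) : P c := by
  let S : AddSubgroup ((complex X).X n) :=
    { carrier := {x | P x}, zero_mem' := zero, add_mem' := add _ _, neg_mem' := neg _ }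
  refine Submodule.span_induction (p := fun x _ => x ∈ S) ?_ zero (fun a b _ _ => add a b) ?_
    (Submodule.eq_top_iff'.mp (span_single n) c)
  · rintro _ ⟨σ, rfl⟩
    exact single σ
  · intro k x _ hx
    exact (congrArg (· ∈ S) (int_smul_eq_zsmul ((complex X).X n).isModule k x)).mpr
      (S.zsmul_mem hx k)

/-- The 1-cycles. -/
noncomputable abbrev cycles (X : Type) [TopologicalSpace X] : Submodule ℤ ((complex X).X 1) :=
  LinearMap.ker ((complex X).d 1 0).hom

theorem iCycles_injective :
    Function.Injective ((complex X).iCycles 1).hom :=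
  (ModuleCat.mono_iff_injective ((complex X).iCycles 1)).mp inferInstance

theorem exists_iCycles_eq (z : cycles X) :
    ∃ y : (complex X).cycles 1, ((complex X).iCycles 1).hom y = z := by
  -- A cycle is read as a morphism out of `ℤ`, to which the universal property of the cycles
  -- applies.
  let k : ModuleCat.of ℤ ℤ ⟶ (complex X).X 1 :=
    ModuleCat.ofHom (LinearMap.toSpanSingleton ℤ ((complex X).X 1) z.1)
  have hk : k ≫ (complex X).d 1 0 = 0 := by
    refine ModuleCat.hom_ext (LinearMap.ext_ring ?_)
    refine Eq.trans (congrArg ((complex X).d 1 0).hom ?_) z.2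
    exact LinearMap.toSpanSingleton_apply_one (R := ℤ) (M := (complex X).X 1) z.1
  refine ⟨((complex X).liftCycles k 0 (by simp) hk).hom (1 : ℤ), ?_⟩
  refine (congrArg (fun f => f.hom (1 : ℤ)) ((complex X).liftCycles_i k 0 (by simp) hk)).trans ?_
  exact LinearMap.toSpanSingleton_apply_one (R := ℤ) (M := (complex X).X 1) z.1

/-- The map from concrete to abstract 1-cycles. -/
noncomputable def toCycles (z : cycles X) : (complex X).cycles 1 := (exists_iCycles_eq z).choose

theorem iCycles_toCycles (z : cycles X) : ((complex X).iCycles 1).hom (toCycles z) = z :=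
  (exists_iCycles_eq z).choose_spec

/-- The homology class of a 1-cycle. -/
noncomputable def homologyClass (X : Type) [TopologicalSpace X] : cycles X →+ H1 X :=
  AddMonoidHom.mk' (fun z => ((complex X).homologyπ 1).hom (toCycles z)) fun a b => by
    have h : toCycles (a + b) = toCycles a + toCycles b := by
      apply iCycles_injective
      rw [map_add, iCycles_toCycles, iCycles_toCycles, iCycles_toCycles]
      rfl
    rw [h]
    exact map_add _ _ _

theorem homologyClass_surjective : Function.Surjective (homologyClass X) := by
  intro c
  obtain ⟨y, rfl⟩ := (ModuleCat.epi_iff_surjective ((complex X).homologyπ 1)).mp inferInstance c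
  have hy : ((complex X).d 1 0).hom (((complex X).iCycles 1).hom y) = 0 :=
    congrArg (fun f => f.hom y) ((complex X).iCycles_d 1 0)
  refine ⟨⟨((complex X).iCycles 1).hom y, hy⟩, ?_⟩
  refine congrArg ((complex X).homologyπ 1).hom
    (iCycles_injective ?_)
  exact iCycles_toCycles _

/-- Homology embeds in the chains modulo boundaries through `homologyι`, so a class vanishes exactly
when its cycle does there. -/
theorem homologyClass_eq_zero_iff (z : cycles X) :
    homologyClass X z = 0 ↔ ∃ w : (complex X).X 2, ((complex X).d 2 1).hom w = z := by
  have h1 : homologyClass X z = 0 ↔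
      ((complex X).homologyι 1).hom (homologyClass X z) = 0 :=
    (map_eq_zero_iff _ ((ModuleCat.mono_iff_injective ((complex X).homologyι 1)).mp
      inferInstance)).symm
  have h2 : ((complex X).homologyι 1).hom (homologyClass X z) =
      ((complex X).pOpcycles 1).hom (z : (complex X).X 1) := by
    have h := congrArg (fun f => f.hom (toCycles z)) ((complex X).homology_π_ι 1)
    refine Eq.trans h ?_
    exact congrArg ((complex X).pOpcycles 1).hom (iCycles_toCycles z)
  rw [h1, h2]
  refine (ShortComplex.moduleCat_pOpcycles_eq_zero_iff ((complex X).sc 1)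
    (z : (complex X).X 1)).trans ?_
  have h3 : (ComplexShape.down ℕ).prev 1 = 2 := ChainComplex.prev ℕ 1
  change (∃ w, ((complex X).d ((ComplexShape.down ℕ).prev 1) 1).hom w = _) ↔ _
  rw [h3]

theorem map_mem_cycles (f : C(X, Y)) (z : cycles X) :
    ((map f).f 1).hom (z : (complex X).X 1) ∈ cycles Y := by
  have h := congrArg (fun g => g.hom (z : (complex X).X 1)) ((map f).comm 1 0)
  refine LinearMap.mem_ker.mpr (Eq.trans h ?_)
  exact (congrArg ((map f).f 0).hom z.2).trans (map_zero _)

theorem H1map_homologyClass (f : C(X, Y)) (z : cycles X) :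
    H1map f (homologyClass X z) =
      homologyClass Y ⟨((map f).f 1).hom (z : (complex X).X 1), map_mem_cycles f z⟩ := by
  have h := congrArg (fun g => g.hom (toCycles z))
    (HomologicalComplex.homologyπ_naturality (map f) 1)
  refine Eq.trans h ?_
  refine congrArg ((complex Y).homologyπ 1).hom
    (iCycles_injective ?_)
  refine Eq.trans ?_ (iCycles_toCycles _).symm
  have h' := congrArg (fun g => g.hom (toCycles z))
    (HomologicalComplex.cyclesMap_i (map f) 1)
  refine Eq.trans h' ?_
  exact congrArg ((map f).f 1).hom (iCycles_toCycles z)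

end SingularChain

/-! ### Coordinates on standard simplices, and chains modulo boundaries -/

namespace SingularChain

theorem face_apply_succAbove {n : ℕ} (i : Fin (n + 2)) (t : stdSimplex ℝ (Fin (n + 1)))
    (j : Fin (n + 1)) : face i t (i.succAbove j) = t j := by
  change FunOnFinite.linearMap ℝ ℝ i.succAbove t (i.succAbove j) = t j
  rw [FunOnFinite.linearMap_apply_apply]
  simp [Finset.filter_eq']

theorem face_apply_self {n : ℕ} (i : Fin (n + 2)) (t : stdSimplex ℝ (Fin (n + 1))) :
    face i t i = 0 := by
  change FunOnFinite.linearMap ℝ ℝ i.succAbove t i = 0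
  rw [FunOnFinite.linearMap_apply_apply]
  simp [Fin.succAbove_ne]

theorem face_one_coords (t : stdSimplex ℝ (Fin 1)) :
    face (n := 0) 0 t 1 = 1 ∧ face (n := 0) 1 t 1 = 0 := by
  refine ⟨(face_apply_succAbove 0 t 0).trans ?_, face_apply_self 1 t⟩
  simp

theorem face_two_coords (t : stdSimplex ℝ (Fin 2)) :
    (face (n := 1) 0 t 0 = 0 ∧ face (n := 1) 0 t 1 = t 0 ∧ face (n := 1) 0 t 2 = t 1) ∧
    (face (n := 1) 1 t 0 = t 0 ∧ face (n := 1) 1 t 1 = 0 ∧ face (n := 1) 1 t 2 = t 1) ∧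
    (face (n := 1) 2 t 0 = t 0 ∧ face (n := 1) 2 t 1 = t 1 ∧ face (n := 1) 2 t 2 = 0) :=
  ⟨⟨face_apply_self 0 t, face_apply_succAbove 0 t 0, face_apply_succAbove 0 t 1⟩,
    ⟨face_apply_succAbove 1 t 0, face_apply_self 1 t, face_apply_succAbove 1 t 1⟩,
    ⟨face_apply_succAbove 2 t 0, face_apply_succAbove 2 t 1, face_apply_self 2 t⟩⟩

/-- Truncation of a real number to `[0, 1]`. -/
noncomputable def clamp (u : ℝ) : ℝ := max 0 (min u 1)

theorem continuous_clamp : Continuous clamp := by unfold clamp; fun_prop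

theorem clamp_nonneg (u : ℝ) : 0 ≤ clamp u := le_max_left _ _

theorem clamp_le_one (u : ℝ) : clamp u ≤ 1 := max_le zero_le_one (min_le_right _ _)

theorem clamp_of_mem {u : ℝ} (h0 : 0 ≤ u) (h1 : u ≤ 1) : clamp u = u := by
  rw [clamp, min_eq_left h1, max_eq_right h0]

@[simp] theorem clamp_zero : clamp 0 = 0 := clamp_of_mem le_rfl zero_le_one

@[simp] theorem clamp_one : clamp 1 = 1 := clamp_of_mem zero_le_one le_rfl

/-- A retraction of the line onto the standard 1-simplex. -/
noncomputable def lineToSimplex : C(ℝ, stdSimplex ℝ (Fin 2)) where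
  toFun u := ⟨![1 - clamp u, clamp u], by
    refine ⟨fun i => ?_, by simp⟩
    fin_cases i
    · simpa using clamp_le_one u
    · exact clamp_nonneg u⟩
  continuous_toFun := by
    refine Continuous.subtype_mk (continuous_pi fun i => ?_) _
    have := continuous_clamp
    fin_cases i <;> simp <;> fun_prop

/-- A surjection of the plane onto the standard 2-simplex. -/
noncomputable def planeToSimplex : C(ℝ × ℝ, stdSimplex ℝ (Fin 3)) where
  toFun x := ⟨![1 - clamp x.1, clamp x.1 * (1 - clamp x.2), clamp x.1 * clamp x.2], by
    have h1 := clamp_le_one x.1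
    have h2 := clamp_le_one x.2
    have h3 := clamp_nonneg x.1
    have h4 := clamp_nonneg x.2
    refine ⟨fun i => ?_, by simp [Fin.sum_univ_three]; ring⟩
    fin_cases i
    · simpa using h1
    · exact mul_nonneg h3 (sub_nonneg.mpr h2)
    · exact mul_nonneg h3 h4⟩
  continuous_toFun := by
    refine Continuous.subtype_mk (continuous_pi fun i => ?_) _
    have := continuous_clamp
    fin_cases i <;> simp <;> fun_prop

theorem lineToSimplex_zero (u : ℝ) : lineToSimplex u 0 = 1 - clamp u := rfl

theorem lineToSimplex_one (u : ℝ) : lineToSimplex u 1 = clamp u := rfl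

theorem planeToSimplex_one (x : ℝ × ℝ) : planeToSimplex x 1 = clamp x.1 * (1 - clamp x.2) := rfl

theorem planeToSimplex_two (x : ℝ × ℝ) : planeToSimplex x 2 = clamp x.1 * clamp x.2 := rfl

@[fun_prop]
theorem continuous_coord {n : ℕ} (i : Fin n) : Continuous fun t : stdSimplex ℝ (Fin n) => t i :=
  (continuous_apply i).comp continuous_subtype_val

theorem simplex_one_ext {s t : stdSimplex ℝ (Fin 2)} (h : s 1 = t 1) : s = t := by
  have hs := stdSimplex.add_eq_one s
  have ht := stdSimplex.add_eq_one t
  refine stdSimplex.ext (funext fun i => ?_)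
  fin_cases i
  · change s 0 = t 0
    linarith
  · exact h

theorem simplex_two_ext {s t : stdSimplex ℝ (Fin 3)} (h : s 1 = t 1) (h' : s 2 = t 2) : s = t := by
  have hs := stdSimplex.sum_eq_one s
  have ht := stdSimplex.sum_eq_one t
  rw [Fin.sum_univ_three] at hs ht
  refine stdSimplex.ext (funext fun i => ?_)
  fin_cases i
  · change s 0 = t 0
    linarith
  · exact h
  · exact h'

theorem lineToSimplex_coord (t : stdSimplex ℝ (Fin 2)) : lineToSimplex (t 1) = t :=
  simplex_one_ext (clamp_of_mem (stdSimplex.zero_le t 1) (stdSimplex.le_one t 1))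

/-- Three sides of the unit square parametrize the faces of the triangle; the fourth, where the
first coordinate is `0`, collapses to a vertex. -/
theorem face_comp_lineToSimplex (u : ℝ) :
    face (n := 1) 0 (lineToSimplex u) = planeToSimplex (1, u) ∧
    face (n := 1) 1 (lineToSimplex u) = planeToSimplex (u, 1) ∧
    face (n := 1) 2 (lineToSimplex u) = planeToSimplex (u, 0) := by
  obtain ⟨⟨-, h1, h2⟩, ⟨-, h3, h4⟩, ⟨-, h5, h6⟩⟩ := face_two_coords (lineToSimplex u)
  refine ⟨simplex_two_ext (h1.trans ?_) (h2.trans ?_), simplex_two_ext (h3.trans ?_) (h4.trans ?_),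
    simplex_two_ext (h5.trans ?_) (h6.trans ?_)⟩ <;>
  simp [lineToSimplex_zero, lineToSimplex_one, planeToSimplex_one, planeToSimplex_two]

/-- One-dimensional chains modulo boundaries. -/
abbrev Coker (X : Type) [TopologicalSpace X] : Type :=
  (complex X).X 1 ⧸ ((complex X).d 2 1).hom.toAddMonoidHom.range

noncomputable abbrev toCoker (X : Type) [TopologicalSpace X] : (complex X).X 1 →+ Coker X :=
  QuotientAddGroup.mk' _

theorem toCoker_eq_zero_iff {X : Type} [TopologicalSpace X] (z : (complex X).X 1) :
    toCoker X z = 0 ↔ ∃ w, ((complex X).d 2 1).hom w = z :=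
  QuotientAddGroup.eq_zero_iff z

theorem toCoker_triangle {X : Type} [TopologicalSpace X] (τ : C(stdSimplex ℝ (Fin 3), X))
    {a b c : C(stdSimplex ℝ (Fin 2), X)} (ha : ∀ t, τ (face 0 t) = a t)
    (hb : ∀ t, τ (face 1 t) = b t) (hc : ∀ t, τ (face 2 t) = c t) :
    toCoker X (single (n := 1) a) - toCoker X (single (n := 1) b) +
      toCoker X (single (n := 1) c) = 0 := by
  rw [← map_sub, ← map_add, toCoker_eq_zero_iff]
  refine ⟨single τ, (d_single_two τ).trans ?_⟩
  rw [show τ.comp (face 0) = a from ContinuousMap.ext ha,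
    show τ.comp (face 1) = b from ContinuousMap.ext hb,
    show τ.comp (face 2) = c from ContinuousMap.ext hc]

end SingularChain

/-- A covering map `p` whose total space is a real vector space, with deck group
the translations by the subgroup `Λ`. -/
structure IsVectorCovering {V : Type} [NormedAddCommGroup V] [NormedSpace ℝ V] {X : Type}
    [TopologicalSpace X] (p : V → X) (Λ : AddSubgroup V) : Prop where
  isCoveringMap : IsCoveringMap p
  surjective : Function.Surjective p
  eq_iff : ∀ v w, p v = p w ↔ v - w ∈ Λ

/-! ### First homology of a vector space modulo periods -/

namespace IsVectorCovering

open SingularChain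

variable {V : Type} [NormedAddCommGroup V] [NormedSpace ℝ V] {X : Type}
    [TopologicalSpace X] {p : V → X} {Λ : AddSubgroup V} (h : IsVectorCovering p Λ)
include h

theorem continuous : Continuous p := h.isCoveringMap.continuous

theorem apply_add {l : V} (hl : l ∈ Λ) (v : V) : p (l + v) = p v :=
  (h.eq_iff _ _).mpr (by simpa using hl)

theorem exists_lift {B : Type} [NormedAddCommGroup B] [NormedSpace ℝ B] (f : C(B, X)) :
    ∃ F : C(B, V), ∀ b, p (F b) = f b := by
  obtain ⟨e, he⟩ := h.surjective (f 0)
  obtain ⟨F, ⟨-, hF⟩, -⟩ := h.isCoveringMap.existsUnique_continuousMap_lifts f 0 e he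
  exact ⟨F, congrFun hF⟩

/-- `F c - G c` is a period, and `G` translated by it is a lift that agrees with `F` at `c`; lifts
on a connected space are unique. -/
theorem lift_sub_lift {B : Type} [NormedAddCommGroup B] [NormedSpace ℝ B] {F G : C(B, V)}
    (hFG : ∀ b, p (F b) = p (G b)) (b c : B) : F b - F c = G b - G c := by
  have hc : F c - G c ∈ Λ := (h.eq_iff _ _).mp (hFG c)
  have := h.isCoveringMap.eq_of_comp_eq (g₁ := F) (g₂ := fun b => (F c - G c) + G b)
    F.continuous (by fun_prop) (funext fun b => (hFG b).trans (h.apply_add hc _).symm) c (by simp)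
  rw [congrFun this b]
  abel

/-- The displacement of a lift of a 1-simplex. -/
noncomputable def displacement (σ : C(stdSimplex ℝ (Fin 2), X)) : V :=
  (h.exists_lift (σ.comp lineToSimplex)).choose 1 - (h.exists_lift (σ.comp lineToSimplex)).choose 0

theorem displacement_eq (σ : C(stdSimplex ℝ (Fin 2), X)) (F : C(ℝ, V))
    (hF : ∀ u, p (F u) = σ (lineToSimplex u)) : h.displacement σ = F 1 - F 0 :=
  h.lift_sub_lift (fun u => ((h.exists_lift (σ.comp lineToSimplex)).choose_spec u).trans
    (hF u).symm) 1 0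

theorem displacement_boundary (τ : C(stdSimplex ℝ (Fin 3), X)) :
    h.displacement (τ.comp (face 0)) - h.displacement (τ.comp (face 1)) +
      h.displacement (τ.comp (face 2)) = 0 := by
  obtain ⟨F, hF⟩ := h.exists_lift (τ.comp planeToSimplex)
  have h0 := h.displacement_eq (τ.comp (face 0)) (F.comp ⟨fun u => (1, u), by fun_prop⟩)
    fun u => (hF (1, u)).trans (congrArg τ (face_comp_lineToSimplex u).1.symm)
  have h1 := h.displacement_eq (τ.comp (face 1)) (F.comp ⟨fun u => (u, 1), by fun_prop⟩)
    fun u => (hF (u, 1)).trans (congrArg τ (face_comp_lineToSimplex u).2.1.symm)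
  have h2 := h.displacement_eq (τ.comp (face 2)) (F.comp ⟨fun u => (u, 0), by fun_prop⟩)
    fun u => (hF (u, 0)).trans (congrArg τ (face_comp_lineToSimplex u).2.2.symm)
  -- This side of the square is collapsed, so a constant is also a lift along it. The other three
  -- displacements then telescope.
  have h3 : F (0, 1) - F (0, 0) = 0 := by
    have := h.lift_sub_lift (F := F.comp ⟨fun u : ℝ => ((0 : ℝ), u), by fun_prop⟩)
      (G := ContinuousMap.const ℝ (F (0, 0))) (fun u => ?_) 1 0
    · simpa using this
    · refine (hF (0, u)).trans (Eq.trans ?_ (hF (0, 0)).symm)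
      exact congrArg τ (simplex_two_ext (by simp [planeToSimplex_one]) (by simp [planeToSimplex_two]))
  rw [h0, h1, h2]
  simp only [ContinuousMap.comp_apply, ContinuousMap.coe_mk]
  rw [← h3]
  abel

/-- Displacement is a cocycle, and it recovers `l` from the segment to `l`; this is why `periodHom`
is injective. -/
theorem desc_displacement_d (w : (complex X).X 2) :
    (desc (n := 1) h.displacement).hom (((complex X).d 2 1).hom w) = 0 := by
  induction w using SingularChain.induction with
  | single τ =>
    refine (congrArg _ (d_single_two τ)).trans ?_
    rw [map_add, map_sub, desc_single, desc_single, desc_single]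
    exact h.displacement_boundary τ
  | zero => simp
  | add a b ha hb => rw [map_add, map_add, ha, hb, add_zero]
  | neg a ha => rw [map_neg, map_neg, ha, neg_zero]

/-- The image in `X` of the segment from `0` to `v`. -/
noncomputable def segment (v : V) : C(stdSimplex ℝ (Fin 2), X) :=
  ⟨fun t => p (t 1 • v), h.continuous.comp (by fun_prop)⟩

theorem displacement_segment (v : V) : h.displacement (h.segment v) = v := by
  rw [h.displacement_eq (h.segment v) ⟨fun u => clamp u • v, continuous_clamp.smul continuous_const⟩
    fun u => rfl]
  simp

/-- Take the image of the triangle with vertices `0`, `l`, `l + v`. Its side from `l` to `l + v` has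
the same image as the segment from `0` to `v`, because `l` is a period. -/
theorem toCoker_segment_add {l : V} (hl : l ∈ Λ) (v : V) :
    toCoker X (single (n := 1) (h.segment (l + v))) =
      toCoker X (single (n := 1) (h.segment l)) + toCoker X (single (n := 1) (h.segment v)) := by
  have key := toCoker_triangle (a := h.segment v) (b := h.segment (l + v)) (c := h.segment l)
    (⟨fun t => p (t 1 • l + t 2 • (l + v)), h.continuous.comp (by fun_prop)⟩ :
      C(stdSimplex ℝ (Fin 3), X)) ?_ ?_ ?_
  · rw [sub_add_eq_add_sub, sub_eq_zero] at key
    rw [← key, add_comm]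
  · intro t
    obtain ⟨⟨-, h1, h2⟩, -⟩ := face_two_coords t
    change p (_ + _) = p _
    rw [h1, h2, ← h.apply_add hl (t 1 • v), smul_add, ← add_assoc, ← add_smul,
      stdSimplex.add_eq_one, one_smul]
  · intro t
    obtain ⟨-, ⟨-, h1, h2⟩, -⟩ := face_two_coords t
    change p (_ + _) = p _
    rw [h1, h2, zero_smul, zero_add]
  · intro t
    obtain ⟨-, -, ⟨-, h1, h2⟩⟩ := face_two_coords t
    change p (_ + _) = p _
    rw [h1, h2, zero_smul, add_zero]

theorem toCoker_segment_zero : toCoker X (single (n := 1) (h.segment 0)) = 0 := by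
  simpa using h.toCoker_segment_add Λ.zero_mem 0

/-- The path and the two segments are joined by two triangles sharing the auxiliary side `u ↦ u • s
u`. Unlike the cone over the path, they need no division by `t 1 + t 2`. -/
theorem toCoker_lift (s : C(ℝ, V)) :
    toCoker X (single (n := 1) ⟨fun t => p (s (t 1)), h.continuous.comp (by fun_prop)⟩) =
      toCoker X (single (n := 1) (h.segment (s 1))) -
        toCoker X (single (n := 1) (h.segment (s 0))) := by
  have hA := toCoker_triangle (a := ⟨fun t => p (s (t 1)), h.continuous.comp (by fun_prop)⟩)
    (b := ⟨fun t => p (t 1 • s (t 1)), h.continuous.comp (by fun_prop)⟩) (c := h.segment (s 0))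
    (⟨fun t => p ((t 1 + t 2) • s (t 2)), h.continuous.comp (by fun_prop)⟩ :
      C(stdSimplex ℝ (Fin 3), X)) ?_ ?_ ?_
  have hB := toCoker_triangle (a := h.segment (s 1))
    (b := ⟨fun t => p (t 1 • s (t 1)), h.continuous.comp (by fun_prop)⟩) (c := h.segment 0)
    (⟨fun t => p (t 2 • s (t 1 + t 2)), h.continuous.comp (by fun_prop)⟩ :
      C(stdSimplex ℝ (Fin 3), X)) ?_ ?_ ?_
  · rw [h.toCoker_segment_zero, add_zero, sub_eq_zero] at hB
    rw [← hB] at hA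
    rw [sub_add, sub_eq_zero] at hA
    exact hA
  all_goals
    intro t
    obtain ⟨⟨-, h1, h2⟩, ⟨-, h3, h4⟩, ⟨-, h5, h6⟩⟩ := face_two_coords t
    change p _ = p _
    simp only [h1, h2, h3, h4, h5, h6, stdSimplex.add_eq_one, one_smul, zero_add, add_zero,
      zero_smul, smul_zero]

/-- Coning a simplex off to `0` along chosen lifts of its endpoints leaves a period segment and a
term that depends only on the boundary. For a cycle that term vanishes, so `periodHom` is
surjective. -/
theorem exists_toCoker_eq (c : (complex X).X 1) : ∃ l ∈ Λ,
    toCoker X c = toCoker X (single (n := 1) (h.segment l)) +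
      (desc (n := 0) fun σ : C(stdSimplex ℝ (Fin 1), X) => toCoker X (single (n := 1)
        (h.segment (Function.surjInv h.surjective (σ default))))).hom
        (((complex X).d 1 0).hom c) := by
  induction c using SingularChain.induction with
  | single σ =>
    obtain ⟨s, hs⟩ := h.exists_lift (σ.comp lineToSimplex)
    have hσ : σ = ⟨fun t => p (s (t 1)), h.continuous.comp (by fun_prop)⟩ := by
      ext t
      refine (congrArg σ (lineToSimplex_coord t).symm).trans (hs _).symm
    have hl : ∀ v, v - Function.surjInv h.surjective (p v) ∈ Λ := fun v =>
      (h.eq_iff _ _).mp (Function.surjInv_eq h.surjective (p v)).symm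
    -- Every vector is a period plus the chosen lift of its image.
    have hg : ∀ v, toCoker X (single (n := 1) (h.segment v)) =
        toCoker X (single (n := 1) (h.segment (v - Function.surjInv h.surjective (p v)))) +
        toCoker X (single (n := 1) (h.segment (Function.surjInv h.surjective (p v)))) := fun v => by
      rw [← h.toCoker_segment_add (hl v), sub_add_cancel]
    refine ⟨_, Λ.sub_mem (hl (s 1)) (hl (s 0)), ?_⟩
    have h0 : σ (face (n := 0) 0 default) = p (s 1) := by
      rw [hσ]; exact congrArg (fun u => p (s u)) (face_one_coords default).1
    have h1 : σ (face (n := 0) 1 default) = p (s 0) := by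
      rw [hσ]; exact congrArg (fun u => p (s u)) (face_one_coords default).2
    have hd : (desc (n := 0) fun σ : C(stdSimplex ℝ (Fin 1), X) => toCoker X (single (n := 1)
        (h.segment (Function.surjInv h.surjective (σ default))))).hom
        (((complex X).d 1 0).hom (single (n := 1) σ)) =
        toCoker X (single (n := 1) (h.segment (Function.surjInv h.surjective (p (s 1))))) -
        toCoker X (single (n := 1) (h.segment (Function.surjInv h.surjective (p (s 0))))) := by
      rw [d_single_one, map_sub, desc_single, desc_single, ← h0, ← h1]
      rfl
    have hsub := h.toCoker_segment_add (Λ.sub_mem (hl (s 1)) (hl (s 0)))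
      (s 0 - Function.surjInv h.surjective (p (s 0)))
    rw [sub_add_cancel] at hsub
    rw [hd, hσ, h.toCoker_lift, hg (s 1), hg (s 0), hsub]
    abel
  | zero => exact ⟨0, Λ.zero_mem, by simp [h.toCoker_segment_zero]⟩
  | add a b ha hb =>
    obtain ⟨l, hl, ha⟩ := ha
    obtain ⟨m, hm, hb⟩ := hb
    refine ⟨l + m, Λ.add_mem hl hm, ?_⟩
    rw [map_add, map_add, map_add, ha, hb, h.toCoker_segment_add hl]
    abel
  | neg a ha =>
    obtain ⟨l, hl, ha⟩ := ha
    refine ⟨-l, Λ.neg_mem hl, ?_⟩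
    have := h.toCoker_segment_add (Λ.neg_mem hl) l
    rw [neg_add_cancel, h.toCoker_segment_zero] at this
    rw [map_neg, map_neg, map_neg, ha, ← sub_eq_zero, eq_neg_of_add_eq_zero_left this.symm]
    abel

theorem segment_mem_cycles (l : Λ) : single (n := 1) (h.segment (l : V)) ∈ cycles X := by
  refine LinearMap.mem_ker.mpr ((d_single_one _).trans ?_)
  rw [sub_eq_zero]
  congr 1
  ext t
  change p _ = p _
  rw [(face_one_coords t).1, (face_one_coords t).2, h.eq_iff]
  simp

/-- The class in `H₁(X, ℤ)` of the image of the segment from `0` to a period. -/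
noncomputable def periodHom : Λ →+ H1 X :=
  AddMonoidHom.mk' (fun l => homologyClass X ⟨single (h.segment (l : V)), h.segment_mem_cycles l⟩)
    fun l m => by
      rw [← map_add, ← sub_eq_zero, ← map_sub, homologyClass_eq_zero_iff, ← toCoker_eq_zero_iff]
      change toCoker X (single (n := 1) (h.segment (l + m : V)) -
        (single (n := 1) (h.segment (l : V)) + single (n := 1) (h.segment (m : V)))) = 0
      rw [map_sub, map_add, h.toCoker_segment_add l.2, sub_self]

theorem periodHom_injective : Function.Injective h.periodHom := by
  refine (injective_iff_map_eq_zero _).mpr fun l hl => ?_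
  obtain ⟨w, hw⟩ := (homologyClass_eq_zero_iff _).mp hl
  have := h.desc_displacement_d w
  rw [hw, desc_single, h.displacement_segment] at this
  exact Subtype.ext this

theorem periodHom_surjective : Function.Surjective h.periodHom := by
  intro c
  obtain ⟨z, rfl⟩ := homologyClass_surjective c
  obtain ⟨l, hl, hz⟩ := h.exists_toCoker_eq z
  refine ⟨⟨l, hl⟩, ?_⟩
  rw [LinearMap.mem_ker.mp z.2, map_zero, add_zero] at hz
  rw [← sub_eq_zero]
  change homologyClass X _ - _ = 0
  rw [← map_sub, homologyClass_eq_zero_iff, ← toCoker_eq_zero_iff]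
  change toCoker X (single (n := 1) (h.segment l) - (z : (complex X).X 1)) = 0
  rw [map_sub, hz, sub_self]

/-- The first homology of a quotient of a vector space by a discrete subgroup is this subgroup. -/
noncomputable def periodEquiv : Λ ≃+ H1 X :=
  AddEquiv.ofBijective h.periodHom ⟨h.periodHom_injective, h.periodHom_surjective⟩

/-- A linear map carries the segment to `l` to the segment to `T l`, so the identity already holds
on chains. -/
theorem H1map_periodEquiv {W : Type} [NormedAddCommGroup W] [NormedSpace ℝ W] {Y : Type}
    [TopologicalSpace Y] {q : W → Y} {Λ' : AddSubgroup W} (h' : IsVectorCovering q Λ')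
    (f : C(X, Y)) (T : V →ₗ[ℝ] W) (hT : ∀ v, f (p v) = q (T v)) (l : Λ) (hl : T l ∈ Λ') :
    H1map f (h.periodEquiv l) = h'.periodEquiv ⟨T l, hl⟩ := by
  refine (H1map_homologyClass f _).trans (congrArg (homologyClass Y) (Subtype.ext ?_))
  refine (map_single f (n := 1) _).trans (congrArg single (ContinuousMap.ext fun t => ?_))
  change f (p _) = q _
  rw [hT, map_smul]

end IsVectorCovering

end SingularHomology

namespace ComplexPoints

open WeierstrassCurve Topology Filter
open scoped WeierstrassCurve.Projective

variable {E : WeierstrassCurve ℝ}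

/-! ### The topological group of complex points -/

/-- The nonsingular homogeneous coordinate vectors of points of `E(ℂ)`. -/
abbrev Cone (E : WeierstrassCurve ℝ) : Type :=
  {v : Fin 3 → ℂ // (E.baseChange ℂ).toProjective.Nonsingular v}

/-- The point of `E(ℂ)` with given homogeneous coordinates. -/
noncomputable def ofCone (v : Cone E) : ComplexPoints E :=
  Projective.Point.toAffine (E.baseChange ℂ) v.1

@[fun_prop]
theorem Cone.continuous_coord (i : Fin 3) : Continuous fun v : Cone E => v.1 i :=
  (continuous_apply i).comp continuous_subtype_val

theorem Cone.ne_zero (v : Cone E) : v.1 ≠ 0 := by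
  intro h
  have := v.2
  rw [h, Projective.nonsingular_of_Z_eq_zero rfl] at this
  simp at this

theorem toProjectivePlane_ofCone (v : Cone E) :
    toProjectivePlane E (ofCone v) = Projectivization.mk ℂ v.1 v.ne_zero := by
  by_cases hz : v.1 2 = 0
  · rw [ofCone, Projective.Point.toAffine_of_Z_eq_zero hz]
    refine (Projectivization.mk_eq_mk_iff' ℂ _ _ _ _).mpr ?_
    have hy := Projective.isUnit_Y_of_Z_eq_zero v.2 hz
    have hx := Projective.X_eq_zero_of_Z_eq_zero v.2.1 hz
    refine ⟨(v.1 1)⁻¹, funext fun i => ?_⟩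
    fin_cases i
    · simp [hx]
    · simp [hy.ne_zero]
    · simp [hz]
  · rw [ofCone, Projective.Point.toAffine_of_Z_ne_zero v.2 hz]
    refine (Projectivization.mk_eq_mk_iff' ℂ _ _ _ _).mpr ⟨(v.1 2)⁻¹, funext fun i => ?_⟩
    fin_cases i
    · simp [div_eq_inv_mul]
    · simp [div_eq_inv_mul]
    · simp [hz]

theorem ofCone_surjective : Function.Surjective (ofCone (E := E)) := by
  rintro (_ | ⟨x, y, h⟩)
  · exact ⟨⟨_, Projective.nonsingular_zero⟩, Projective.Point.toAffine_zero⟩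
  · exact ⟨⟨_, (Projective.nonsingular_some x y).mpr h⟩, Projective.Point.toAffine_some ((Projective.nonsingular_some x y).mpr h)⟩

theorem ofCone_eq_of_mk_eq {u : Fin 3 → ℂ} (hu : u ≠ 0) (v : Cone E)
    (h : Projectivization.mk ℂ u hu = Projectivization.mk ℂ v.1 v.ne_zero) :
    ∃ hu' : (E.baseChange ℂ).toProjective.Nonsingular u, ofCone ⟨u, hu'⟩ = ofCone v := by
  obtain ⟨a, ha⟩ := (Projectivization.mk_eq_mk_iff ℂ _ _ _ _).mp h
  have ha' : (a : ℂ) • v.1 = u := ha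
  refine ⟨?_, ?_⟩
  · rw [← ha']
    exact (Projective.nonsingular_smul v.1 a.isUnit).mpr v.2
  · simp only [ofCone, ← ha']
    exact Projective.Point.toAffine_smul v.1 a.isUnit

theorem ofCone_eq_iff {v w : Cone E} : ofCone v = ofCone w ↔ v.1 ≈ w.1 := by
  refine ⟨fun h => ?_, Projective.Point.toAffine_of_equiv⟩
  have h' := congrArg (toProjectivePlane E) h
  rw [toProjectivePlane_ofCone, toProjectivePlane_ofCone] at h'
  exact (Projectivization.mk_eq_mk_iff ℂ _ _ _ _).mp h'

/-- The saturation of an open set is the union of its preimages under scalings. -/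
theorem isOpenMap_projectivization_mk :
    IsOpenMap (Projectivization.mk' ℂ : {v : Fin 3 → ℂ // v ≠ 0} → ℙ ℂ (Fin 3 → ℂ)) := by
  intro U hU
  refine isOpen_coinduced.mpr ?_
  have : Projectivization.mk' ℂ ⁻¹' (Projectivization.mk' ℂ '' U) =
      ⋃ a : ℂˣ, (fun v : {v : Fin 3 → ℂ // v ≠ 0} =>
        (⟨(a : ℂ) • v.1, smul_ne_zero a.ne_zero v.2⟩ : {v : Fin 3 → ℂ // v ≠ 0})) ⁻¹' U := by
    ext v
    simp only [Set.mem_preimage, Set.mem_image, Set.mem_iUnion]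
    constructor
    · rintro ⟨u, hu, huv⟩
      obtain ⟨a, ha⟩ := (Projectivization.mk_eq_mk_iff ℂ _ _ u.2 v.2).mp huv
      refine ⟨a, ?_⟩
      convert hu using 1
      exact Subtype.ext ha
    · rintro ⟨a, ha⟩
      exact ⟨_, ha, (Projectivization.mk_eq_mk_iff ℂ _ _ _ v.2).mpr ⟨a, rfl⟩⟩
  rw [this]
  exact isOpen_iUnion fun a => hU.preimage (by fun_prop)

theorem continuous_projectivization_mk :
    Continuous (Projectivization.mk' ℂ : {v : Fin 3 → ℂ // v ≠ 0} → ℙ ℂ (Fin 3 → ℂ)) :=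
  continuous_coinduced_rng

/-- Continuity on `E(ℂ)` can thus be tested on homogeneous coordinates. Openness matters because
open quotient maps, unlike general ones, are stable under products, as addition requires. -/
theorem isOpenQuotientMap_ofCone : IsOpenQuotientMap (ofCone (E := E)) where
  surjective := ofCone_surjective
  continuous := by
    refine continuous_induced_rng.mpr ?_
    have : toProjectivePlane E ∘ ofCone =
        Projectivization.mk' ℂ ∘ fun v : Cone E => ⟨v.1, v.ne_zero⟩ :=
      funext toProjectivePlane_ofCone
    rw [this]
    exact continuous_projectivization_mk.comp (by fun_prop)
  isOpenMap := by
    rintro _ ⟨U, hU, rfl⟩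
    refine ⟨Projectivization.mk' ℂ '' (Subtype.val ⁻¹' U), isOpenMap_projectivization_mk _
      (hU.preimage continuous_subtype_val), ?_⟩
    ext P
    obtain ⟨v, rfl⟩ := ofCone_surjective P
    simp only [Set.mem_preimage, Set.mem_image]
    rw [toProjectivePlane_ofCone]
    constructor
    · rintro ⟨u, hu, huv⟩
      obtain ⟨h1, h2⟩ := ofCone_eq_of_mk_eq u.2 v huv
      exact ⟨_, hu, h2⟩
    · rintro ⟨u, hu, huv⟩
      refine ⟨⟨u.1, u.ne_zero⟩, hu, ?_⟩
      have := congrArg (toProjectivePlane E) huv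
      rw [toProjectivePlane_ofCone, toProjectivePlane_ofCone] at this
      exact this

/-- A function to `E(ℂ)` is continuous at a point if it is given near the point by homogeneous
coordinates that depend continuously. -/
theorem continuousAt_of_coordinates {B : Type*} [TopologicalSpace B] {b : B}
    {f : B → ComplexPoints E} {g : B → Fin 3 → ℂ} (hg : ContinuousAt g b)
    (hgns : ∀ᶠ x in 𝓝 b, (E.baseChange ℂ).toProjective.Nonsingular (g x))
    (hfg : ∀ᶠ x in 𝓝 b, f x = Projective.Point.toAffine (E.baseChange ℂ) (g x)) :
    ContinuousAt f b := by
  set v0 : Cone E := ⟨g b, hgns.self_of_nhds⟩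
  classical
  let g' : B → Cone E := fun x => if h : (E.baseChange ℂ).toProjective.Nonsingular (g x) then
    ⟨g x, h⟩ else v0
  have hg' : ∀ᶠ x in 𝓝 b, (g' x).1 = g x := hgns.mono fun x hx => by simp [g', hx]
  have h1 : ContinuousAt g' b :=
    IsInducing.subtypeVal.continuousAt_iff.mpr (hg.congr (hg'.mono fun x hx => hx.symm))
  have h2 : ContinuousAt (fun x => ofCone (g' x)) b :=
    ContinuousAt.comp (g := ofCone) isOpenQuotientMap_ofCone.continuous.continuousAt h1
  refine h2.congr ?_
  filter_upwards [hg', hfg] with x hx hx'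
  rw [hx', ← hx]
  rfl

theorem isClosed_singleton_zero : IsClosed ({0} : Set (ComplexPoints E)) := by
  have : ofCone ⁻¹' ({0} : Set (ComplexPoints E)) = {v : Cone E | v.1 2 = 0} := by
    ext v
    simp only [Set.mem_preimage, Set.mem_singleton_iff, Set.mem_ofPred_eq]
    refine ⟨fun h => ?_, Projective.Point.toAffine_of_Z_eq_zero⟩
    by_contra hz
    rw [ofCone, Projective.Point.toAffine_of_Z_ne_zero v.2 hz] at h
    exact Affine.Point.some_ne_zero _ h
  rw [← isOpenQuotientMap_ofCone.isQuotientMap.isClosed_preimage, this]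
  exact isClosed_eq (by fun_prop) continuous_const

theorem continuous_neg : Continuous fun P : ComplexPoints E => -P := by
  refine isOpenQuotientMap_ofCone.continuous_comp_iff.mp (continuous_iff_continuousAt.mpr fun v => ?_)
  refine continuousAt_of_coordinates (g := fun v : Cone E => (E.baseChange ℂ).toProjective.neg v.1)
    ?_ (.of_forall fun v => Projective.nonsingular_neg v.2)
    (.of_forall fun v => (Projective.Point.toAffine_neg v.2).symm)
  refine Continuous.continuousAt (continuous_pi fun i => ?_)
  fin_cases i <;> simp [Projective.neg, Projective.negY] <;> fun_prop

theorem continuous_addXYZ : Continuous fun v : (Fin 3 → ℂ) × (Fin 3 → ℂ) =>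
    (E.baseChange ℂ).toProjective.addXYZ v.1 v.2 := by
  refine continuous_pi fun i => ?_
  fin_cases i
  · simp only [Projective.addXYZ, Projective.addX, Fin.zero_eta, Matrix.cons_val_zero]
    fun_prop
  · simp only [Projective.addXYZ, Projective.addY, Projective.negAddY, Projective.negY,
      Projective.addX, Projective.addZ, Fin.mk_one, Matrix.cons_val_one, Matrix.cons_val_zero,
      Projective.fin3_def_ext]
    fun_prop
  · simp [Projective.addXYZ, Projective.addZ]
    fun_prop

/-- The chord formula vanishes on the diagonal. With `addXYZ_ne_zero`, its nonvanishing is an open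
condition that detects distinct points. -/
theorem not_equiv_of_addXYZ_ne_zero {x y : Fin 3 → ℂ}
    (h : (E.baseChange ℂ).toProjective.addXYZ x y ≠ 0) : ¬ x ≈ y := by
  rintro ⟨a, rfl⟩
  refine h ?_
  have := Projective.addXYZ_smul (W' := E.baseChange ℂ) y y (a : ℂ) 1
  rw [one_smul, Projective.addXYZ_self] at this
  exact this.trans (by simp)

theorem addXYZ_ne_zero {v w : Cone E} (h : ¬ v.1 ≈ w.1) :
    (E.baseChange ℂ).toProjective.addXYZ v.1 w.1 ≠ 0 := by
  rw [← Projective.add_of_not_equiv h]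
  exact Cone.ne_zero ⟨_, Projective.nonsingular_add v.2 w.2⟩

theorem continuousAt_add_ofCone {v w : Cone E} (h : ¬ v.1 ≈ w.1) :
    ContinuousAt (fun x : Cone E × Cone E => ofCone x.1 + ofCone x.2) (v, w) := by
  have hc : Continuous fun x : Cone E × Cone E =>
      (E.baseChange ℂ).toProjective.addXYZ x.1.1 x.2.1 :=
    (continuous_addXYZ (E := E)).comp (f := fun x : Cone E × Cone E => (x.1.1, x.2.1)) (by fun_prop)
  have hev : ∀ᶠ x in 𝓝 (v, w), ¬ x.1.1 ≈ x.2.1 :=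
    (hc.continuousAt.eventually_ne (addXYZ_ne_zero h)).mono fun x => not_equiv_of_addXYZ_ne_zero
  refine continuousAt_of_coordinates hc.continuousAt (hev.mono fun x hx => ?_)
    (hev.mono fun x hx => ?_)
  · rw [← Projective.add_of_not_equiv hx]
    exact Projective.nonsingular_add x.1.2 x.2.2
  · rw [← Projective.add_of_not_equiv hx]
    exact (Projective.Point.toAffine_add x.1.2 x.2.2).symm

theorem continuousAt_add_of_ne {P Q : ComplexPoints E} (hPQ : P ≠ Q) :
    ContinuousAt (fun x : ComplexPoints E × ComplexPoints E => x.1 + x.2) (P, Q) := by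
  obtain ⟨v, rfl⟩ := ofCone_surjective P
  obtain ⟨w, rfl⟩ := ofCone_surjective Q
  have hq := (isOpenQuotientMap_ofCone (E := E)).prodMap (isOpenQuotientMap_ofCone (E := E))
  have := continuousAt_add_ofCone (mt ofCone_eq_iff.mpr hPQ)
  exact (hq.continuousAt_comp_iff (g := fun x : ComplexPoints E × ComplexPoints E => x.1 + x.2) (x := (v, w))).mp this

end ComplexPoints

namespace ComplexPoints

open WeierstrassCurve Topology Filter

variable {E : WeierstrassCurve ℝ}

/-! ### Affine coordinates -/

/-- The derivative of the Weierstrass equation with respect to `y`. -/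
noncomputable def psi (E : WeierstrassCurve ℝ) (x y : ℂ) : ℂ :=
  2 * y + (E.baseChange ℂ).a₁ * x + (E.baseChange ℂ).a₃

/-- The cubic polynomial that vanishes at the `x`-coordinates of the points of order two. -/
noncomputable def cubic (E : WeierstrassCurve ℝ) (x : ℂ) : ℂ :=
  4 * x ^ 3 + (E.baseChange ℂ).b₂ * x ^ 2 + 2 * (E.baseChange ℂ).b₄ * x + (E.baseChange ℂ).b₆

/-- Completing the square: choosing a point over `x` amounts to choosing a square root of `cubic E
x`. -/
theorem equation_iff_psi_sq (x y : ℂ) :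
    (E.baseChange ℂ).toAffine.Equation x y ↔ psi E x y ^ 2 = cubic E x := by
  rw [Affine.equation_iff, psi, cubic, b₂, b₄, b₆]
  constructor <;> intro h
  · linear_combination 4 * h
  · linear_combination (1 / 4 : ℂ) * h

theorem finite_cubic_zeros : {x | cubic E x = 0}.Finite := by
  have h : (E.baseChange ℂ).twoTorsionPolynomial.toPoly ≠ 0 :=
    Cubic.ne_zero_of_a_ne_zero (by simp [twoTorsionPolynomial])
  refine (Polynomial.finite_setOfPred_isRoot h).subset fun x hx => ?_
  simpa [Polynomial.IsRoot, Cubic.toPoly, twoTorsionPolynomial, cubic] using hx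

theorem exists_cubic_ne_zero {s : Set ℂ} (hs : s.Finite) : ∃ x ∉ s, cubic E x ≠ 0 := by
  obtain ⟨x, hx⟩ := ((finite_cubic_zeros (E := E)).union hs).infinite_compl.nonempty
  exact ⟨x, fun h => hx (Or.inr h), fun h => hx (Or.inl h)⟩

theorem exists_equation (x : ℂ) : ∃ y, (E.baseChange ℂ).toAffine.Equation x y := by
  obtain ⟨s, hs⟩ := IsAlgClosed.exists_pow_nat_eq (cubic E x) two_pos
  refine ⟨(s - (E.baseChange ℂ).a₁ * x - (E.baseChange ℂ).a₃) / 2, ?_⟩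
  rw [equation_iff_psi_sq, ← hs, psi]
  ring

/-- The `x`-coordinate of a point, with the value `0` at infinity. -/
noncomputable def xCoord : ComplexPoints E → ℂ
  | .zero => 0
  | .some x _ _ => x

/-- The `y`-coordinate of a point, with the value `0` at infinity. -/
noncomputable def yCoord : ComplexPoints E → ℂ
  | .zero => 0
  | .some _ y _ => y

@[simp] theorem xCoord_some {x y : ℂ} (h) :
    xCoord (E := E) (.some x y h) = x := rfl

@[simp] theorem yCoord_some {x y : ℂ} (h) :
    yCoord (E := E) (.some x y h) = y := rfl

theorem equation_coord {P : ComplexPoints E} (hP : P ≠ 0) :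
    (E.baseChange ℂ).toAffine.Equation (xCoord P) (yCoord P) := by
  rcases P with _ | ⟨x, y, h⟩
  · exact absurd rfl hP
  · exact h.1

theorem ext_coord {P Q : ComplexPoints E} (hP : P ≠ 0) (hQ : Q ≠ 0) (hx : xCoord P = xCoord Q)
    (hy : yCoord P = yCoord Q) : P = Q := by
  rcases P with _ | ⟨x, y, h⟩
  · exact absurd rfl hP
  rcases Q with _ | ⟨x', y', h'⟩
  · exact absurd rfl hQ
  obtain rfl : x = x' := hx
  obtain rfl : y = y' := hy
  rfl

theorem eq_or_eq_neg_of_xCoord_eq {P Q : ComplexPoints E} (hP : P ≠ 0) (hQ : Q ≠ 0)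
    (hx : xCoord P = xCoord Q) : P = Q ∨ P = -Q := by
  rcases P with _ | ⟨x, y, h⟩
  · exact absurd rfl hP
  rcases Q with _ | ⟨x', y', h'⟩
  · exact absurd rfl hQ
  exact Affine.Point.X_eq_iff.mp hx

theorem xCoord_neg (P : ComplexPoints E) : xCoord (-P) = xCoord P := by
  rcases P with _ | ⟨x, y, h⟩ <;> rfl

theorem psi_neg {P : ComplexPoints E} (hP : P ≠ 0) :
    psi E (xCoord (-P)) (yCoord (-P)) = - psi E (xCoord P) (yCoord P) := by
  rcases P with _ | ⟨x, y, h⟩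
  · exact absurd rfl hP
  · change psi E x ((E.baseChange ℂ).toAffine.negY x y) = - psi E x y
    rw [psi, psi, Affine.negY]
    ring

theorem coord_ofCone {v : Cone E} (hv : v.1 2 ≠ 0) :
    xCoord (ofCone v) = v.1 0 / v.1 2 ∧ yCoord (ofCone v) = v.1 1 / v.1 2 := by
  rw [ofCone, Projective.Point.toAffine_of_Z_ne_zero v.2 hv]
  exact ⟨rfl, rfl⟩

theorem ofCone_ne_zero_iff (v : Cone E) : ofCone v ≠ 0 ↔ v.1 2 ≠ 0 := by
  refine ⟨mt Projective.Point.toAffine_of_Z_eq_zero, fun h => ?_⟩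
  rw [ofCone, Projective.Point.toAffine_of_Z_ne_zero v.2 h]
  exact Affine.Point.some_ne_zero _

theorem continuousAt_xCoord {P : ComplexPoints E} (hP : P ≠ 0) : ContinuousAt xCoord P := by
  obtain ⟨v, rfl⟩ := ofCone_surjective P
  have hv := (ofCone_ne_zero_iff v).mp hP
  refine isOpenQuotientMap_ofCone.continuousAt_comp_iff.mp ?_
  have : ContinuousAt (fun v : Cone E => v.1 0 / v.1 2) v :=
    ContinuousAt.div (Cone.continuous_coord _).continuousAt
      (Cone.continuous_coord _).continuousAt hv
  refine this.congr ?_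
  filter_upwards [(Cone.continuous_coord 2).continuousAt.eventually_ne hv] with w hw
  exact (coord_ofCone hw).1.symm

theorem continuousAt_yCoord {P : ComplexPoints E} (hP : P ≠ 0) : ContinuousAt yCoord P := by
  obtain ⟨v, rfl⟩ := ofCone_surjective P
  have hv := (ofCone_ne_zero_iff v).mp hP
  refine isOpenQuotientMap_ofCone.continuousAt_comp_iff.mp ?_
  have : ContinuousAt (fun v : Cone E => v.1 1 / v.1 2) v :=
    ContinuousAt.div (Cone.continuous_coord _).continuousAt
      (Cone.continuous_coord _).continuousAt hv
  refine this.congr ?_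
  filter_upwards [(Cone.continuous_coord 2).continuousAt.eventually_ne hv] with w hw
  exact (coord_ofCone hw).2.symm

/-- The affine point with given coordinates, or `0` if these do not satisfy the equation. -/
noncomputable def ofXY (E : WeierstrassCurve ℝ) (x y : ℂ) : ComplexPoints E :=
  Projective.Point.toAffine (E.baseChange ℂ) ![x, y, 1]

variable [E.IsElliptic]

theorem nonsingular_of_equation {x y : ℂ} (h : (E.baseChange ℂ).toAffine.Equation x y) :
    (E.baseChange ℂ).toAffine.Nonsingular x y := by
  have : (E.baseChange ℂ).IsElliptic := inferInstanceAs (E.map (algebraMap ℝ ℂ)).IsElliptic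
  exact (Affine.equation_iff_nonsingular (W := E.baseChange ℂ)).mp h

theorem ofXY_eq {x y : ℂ} (h : (E.baseChange ℂ).toAffine.Equation x y) :
    ofXY E x y = .some x y (nonsingular_of_equation h) :=
  Projective.Point.toAffine_some
    ((Projective.nonsingular_some x y).mpr (nonsingular_of_equation h))

theorem ofXY_ne_zero {x y : ℂ} (h : (E.baseChange ℂ).toAffine.Equation x y) :
    ofXY E x y ≠ 0 := by
  rw [ofXY_eq h]
  exact Affine.Point.some_ne_zero _

theorem xCoord_ofXY {x y : ℂ} (h : (E.baseChange ℂ).toAffine.Equation x y) :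
    xCoord (ofXY E x y) = x := by rw [ofXY_eq h, xCoord_some]

theorem yCoord_ofXY {x y : ℂ} (h : (E.baseChange ℂ).toAffine.Equation x y) :
    yCoord (ofXY E x y) = y := by rw [ofXY_eq h, yCoord_some]

theorem ofXY_coord {P : ComplexPoints E} (hP : P ≠ 0) : ofXY E (xCoord P) (yCoord P) = P :=
  have h := equation_coord hP
  ext_coord (ofXY_ne_zero h) hP (xCoord_ofXY h) (yCoord_ofXY h)

theorem continuousAt_ofXY {B : Type*} [TopologicalSpace B] {f g : B → ℂ} {b : B}
    (hf : ContinuousAt f b) (hg : ContinuousAt g b)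
    (h : ∀ᶠ x in 𝓝 b, (E.baseChange ℂ).toAffine.Equation (f x) (g x)) :
    ContinuousAt (fun x => ofXY E (f x) (g x)) b := by
  refine continuousAt_of_coordinates (g := fun x => ![f x, g x, 1]) ?_ ?_ (.of_forall fun x => rfl)
  · refine continuousAt_pi.mpr fun i => ?_
    fin_cases i
    exacts [hf, hg, continuousAt_const]
  · exact h.mono fun x hx =>
      (Projective.nonsingular_some _ _).mpr (nonsingular_of_equation hx)

theorem exists_point_avoiding {s : Set ℂ} (hs : s.Finite) :
    ∃ T : ComplexPoints E, T ≠ 0 ∧ T ≠ -T ∧ xCoord T ∉ s ∧ cubic E (xCoord T) ≠ 0 := by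
  obtain ⟨x, hxs, hx⟩ := exists_cubic_ne_zero (E := E) hs
  obtain ⟨y, hy⟩ := exists_equation (E := E) x
  have h0 := ofXY_ne_zero hy
  refine ⟨ofXY E x y, h0, fun h => hx ?_, by rwa [xCoord_ofXY hy], by rwa [xCoord_ofXY hy]⟩
  have h1 := psi_neg h0
  rw [← h, xCoord_ofXY hy, yCoord_ofXY hy] at h1
  rw [← (equation_iff_psi_sq x y).mp hy, self_eq_neg.mp h1]
  ring

/-- On the diagonal, where the chord formula fails, the sum is rewritten as `(x.1 + T) + (x.2 - T)`.
The conditions `P ≠ ±T` and `T ≠ -T` make the summands distinct in all three additions. -/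
theorem continuous_add : Continuous fun x : ComplexPoints E × ComplexPoints E => x.1 + x.2 := by
  refine continuous_iff_continuousAt.mpr fun ⟨P, Q⟩ => ?_
  by_cases hPQ : P = Q
  · subst hPQ
    obtain ⟨T, hT0, hT, hTP, -⟩ := exists_point_avoiding (E := E) (Set.finite_singleton (xCoord P))
    have h1 : P ≠ T := fun h => hTP (by simp [h])
    have h2 : P ≠ -T := fun h => hTP (by simp [h, xCoord_neg])
    have h3 : P + T ≠ P + -T := fun h => hT (add_left_cancel h)
    have c1 : ContinuousAt (fun x : ComplexPoints E × ComplexPoints E => x.1 + T) (P, P) :=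
      (continuousAt_add_of_ne h1).comp
        (f := fun x : ComplexPoints E × ComplexPoints E => (x.1, T)) (x := (P, P)) (by fun_prop)
    have c2 : ContinuousAt (fun x : ComplexPoints E × ComplexPoints E => x.2 + -T) (P, P) :=
      (continuousAt_add_of_ne h2).comp
        (f := fun x : ComplexPoints E × ComplexPoints E => (x.2, -T)) (x := (P, P)) (by fun_prop)
    have c3 := (continuousAt_add_of_ne h3).comp
        (f := fun x : ComplexPoints E × ComplexPoints E => (x.1 + T, x.2 + -T)) (x := (P, P))
        (c1.prodMk c2)
    refine c3.congr (.of_forall fun x => ?_)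
    simp only [Function.comp]
    abel
  · exact continuousAt_add_of_ne hPQ

instance : IsTopologicalAddGroup (ComplexPoints E) where
  continuous_add := continuous_add
  continuous_neg := continuous_neg

end ComplexPoints

section LocalHomeomorph

open Topology Filter

/-! ### Extension of local homomorphisms from vector spaces -/

section LocalHom

variable {V : Type} [NormedAddCommGroup V] [NormedSpace ℝ V] {A : Type} [AddCommGroup A]

theorem tendsto_two_inv_pow_smul (v : V) :
    Tendsto (fun n : ℕ => ((2 : ℝ)⁻¹ ^ n) • v) atTop (𝓝 0) := by
  have h := (tendsto_pow_atTop_nhds_zero_of_lt_one (r := (2 : ℝ)⁻¹) (by norm_num)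
    (by norm_num)).smul_const v
  rwa [zero_smul] at h

theorem two_inv_pow_succ_smul (v : V) (n : ℕ) :
    ((2 : ℝ)⁻¹ ^ (n + 1)) • v + ((2 : ℝ)⁻¹ ^ (n + 1)) • v = ((2 : ℝ)⁻¹ ^ n) • v := by
  rw [← add_smul]
  congr 1
  rw [pow_succ]
  ring

/-- Once the halves of `v` are small enough, `e` doubles under doubling, so `2 ^ n • e (v / 2 ^ n)`
no longer depends on `n`. -/
theorem exists_eventually_eq_of_local_add {e : V → A}
    (hadd : ∀ᶠ x : V × V in 𝓝 (0, 0), e (x.1 + x.2) = e x.1 + e x.2) (v : V) :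
    ∃ a : A, ∀ᶠ n : ℕ in atTop, 2 ^ n • e (((2 : ℝ)⁻¹ ^ n) • v) = a := by
  have h1 := (tendsto_two_inv_pow_smul v).comp (tendsto_add_atTop_nat 1)
  obtain ⟨N, hN⟩ := eventually_atTop.mp ((h1.prodMk_nhds h1).eventually hadd)
  refine ⟨2 ^ N • e (((2 : ℝ)⁻¹ ^ N) • v), eventually_atTop.mpr ⟨N, fun n hn => ?_⟩⟩
  induction n, hn using Nat.le_induction with
  | base => rfl
  | succ n hn ih =>
    have := hN n hn
    simp only [Function.comp] at this
    rw [two_inv_pow_succ_smul] at this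
    rw [← ih, this, pow_succ, mul_smul, two_smul]

/-- The extension to a vector space of a homomorphism defined near zero. -/
theorem exists_addMonoidHom_of_local_add {e : V → A}
    (hadd : ∀ᶠ x : V × V in 𝓝 (0, 0), e (x.1 + x.2) = e x.1 + e x.2) :
    ∃ p : V →+ A, ∀ᶠ v in 𝓝 0, p v = e v := by
  choose p hp using exists_eventually_eq_of_local_add hadd
  refine ⟨AddMonoidHom.mk' p fun v w => ?_, ?_⟩
  · have h := ((tendsto_two_inv_pow_smul v).prodMk_nhds (tendsto_two_inv_pow_smul w)).eventually hadd
    obtain ⟨n, h1, h2, h3, h4⟩ := (h.and ((hp v).and ((hp w).and (hp (v + w))))).exists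
    rw [← h2, ← h3, ← h4, smul_add ((2 : ℝ)⁻¹ ^ n), h1, smul_add]
  · obtain ⟨r, hr, hball⟩ := Metric.eventually_nhds_iff_ball.mp hadd
    filter_upwards [Metric.ball_mem_nhds (0 : V) hr] with v hv
    -- In a ball where additivity holds, the sequence is constant from `n = 0`.
    have hn : ∀ n : ℕ, 2 ^ n • e (((2 : ℝ)⁻¹ ^ n) • v) = e v := by
      intro n
      induction n with
      | zero => simp
      | succ n ih =>
        have hm : ((2 : ℝ)⁻¹ ^ (n + 1)) • v ∈ Metric.ball (0 : V) r := by
          rw [mem_ball_zero_iff] at hv ⊢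
          rw [norm_smul, norm_pow]
          refine lt_of_le_of_lt (mul_le_of_le_one_left (norm_nonneg v) ?_) hv
          exact pow_le_one₀ (norm_nonneg _) (by norm_num)
        have := hball (_, _) (ball_prod_same (0 : V) (0 : V) r ▸ Set.mk_mem_prod hm hm)
        simp only [two_inv_pow_succ_smul] at this
        rw [← ih, this, pow_succ, mul_smul, two_smul]
    obtain ⟨n, h⟩ := (hp v).exists
    exact h.symm.trans (hn n)

end LocalHom

/-- A homomorphism from a vector space to a topological group that is invertible near zero is
continuous, open, and has a discrete kernel. -/
theorem addMonoidHom_local_homeo {V : Type} [NormedAddCommGroup V] {A : Type}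
    [AddCommGroup A] [TopologicalSpace A] [IsTopologicalAddGroup A] {e : V → A} {l : A → V}
    (he : Tendsto e (𝓝 0) (𝓝 0)) (hl : Tendsto l (𝓝 0) (𝓝 0))
    (hle : ∀ᶠ v in 𝓝 0, l (e v) = v) (hel : ∀ᶠ a in 𝓝 0, e (l a) = a)
    {p : V →+ A} (hp : ∀ᶠ v in 𝓝 0, p v = e v) :
    Continuous p ∧ IsOpenMap p ∧ IsDiscrete (p.ker : Set V) := by
  -- One inequality gives continuity and the other openness at `0`; translation carries both to
  -- every point.
  have hmap : map p (𝓝 0) = 𝓝 0 := by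
    rw [Filter.map_congr hp]
    refine le_antisymm he ?_
    calc 𝓝 (0 : A) = map (e ∘ l) (𝓝 0) := by
          rw [Filter.map_congr (show e ∘ l =ᶠ[𝓝 0] id from hel)]
          exact Filter.map_id.symm
      _ = map e (map l (𝓝 0)) := Filter.map_map.symm
      _ ≤ map e (𝓝 0) := Filter.map_mono hl
  refine ⟨continuous_of_continuousAt_zero p ?_, ?_, ?_⟩
  · rw [ContinuousAt, map_zero]
    exact hmap.le
  · refine IsOpenMap.of_nhds_le fun v => ?_
    rw [← map_add_left_nhds_zero (p v), ← hmap, ← map_add_left_nhds_zero v, Filter.map_map,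
      Filter.map_map]
    refine (Filter.map_congr (.of_forall fun w => ?_)).le
    simp
  · have hd : DiscreteTopology p.ker := by
      refine discreteTopology_of_isOpen_singleton_zero ?_
      have h0 : ∀ᶠ v in 𝓝 (0 : V), v ∈ p.ker → v = 0 := by
        filter_upwards [hp, hle] with v h1 h2 h3
        have h4 := hle.self_of_nhds
        have h5 := hp.self_of_nhds
        rw [map_zero] at h5
        rw [← h2, ← h1, AddMonoidHom.mem_ker.mp h3, h5, h4]
      obtain ⟨U, hU, hUo, h0U⟩ := mem_nhds_iff.mp h0
      refine ⟨U, hUo, ?_⟩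
      ext v
      simp only [Set.mem_preimage, Set.mem_singleton_iff]
      refine ⟨fun h => Subtype.ext (hU h v.2), fun h => ?_⟩
      rw [h]
      exact h0U
    exact ⟨hd⟩

end LocalHomeomorph

namespace ComplexPoints

open WeierstrassCurve Topology Filter

variable {E : WeierstrassCurve ℝ}

/-! ### The local logarithm -/

theorem differentiable_cubic : Differentiable ℂ (cubic E) := by
  unfold cubic
  fun_prop

/-- Near `x₀` the ratio `cubic E x / cubic E x₀` is close to `1`, so its principal logarithm can be
halved. -/
theorem exists_sqrt_cubic {x₀ s₀ : ℂ} (hs₀ : s₀ ^ 2 = cubic E x₀) (h0 : s₀ ≠ 0) :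
    ∃ r > 0, ∃ s : ℂ → ℂ, s x₀ = s₀ ∧ ∀ x ∈ Metric.ball x₀ r,
      s x ^ 2 = cubic E x ∧ DifferentiableAt ℂ s x ∧ s x ≠ 0 := by
  have hc0 : cubic E x₀ ≠ 0 := hs₀ ▸ pow_ne_zero 2 h0
  have hd : Differentiable ℂ fun x => cubic E x / cubic E x₀ :=
    differentiable_cubic.div_const _
  have hev : ∀ᶠ x in 𝓝 x₀, cubic E x / cubic E x₀ ∈ Complex.slitPlane := by
    refine hd.continuous.continuousAt.eventually_mem (Complex.isOpen_slitPlane.mem_nhds ?_)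
    rw [div_self hc0]
    exact Complex.one_mem_slitPlane
  obtain ⟨r, hr, hball⟩ := Metric.eventually_nhds_iff_ball.mp hev
  refine ⟨r, hr, fun x => s₀ * Complex.exp (Complex.log (cubic E x / cubic E x₀) / 2), ?_, ?_⟩
  · simp [div_self hc0]
  · intro x hx
    have hx' := hball x hx
    refine ⟨?_, ?_, mul_ne_zero h0 (Complex.exp_ne_zero _)⟩
    · rw [mul_pow, ← Complex.exp_nat_mul, hs₀, Nat.cast_ofNat, mul_div_cancel₀ _ two_ne_zero,
        Complex.exp_log (Complex.slitPlane_ne_zero hx'), mul_div_cancel₀ _ hc0]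
    · exact (((hd x).clog hx').div_const 2).cexp.const_mul s₀

/-- The derivative of the slope of the chord through a moving point and a fixed point. -/
theorem slope_derivative_identity {a₁ a₂ a₃ a₄ a₆ x₁ y₁ x₂ y₂ y' l : ℂ} (hx : x₁ ≠ x₂)
    (h₁ : y₁ ^ 2 + a₁ * x₁ * y₁ + a₃ * y₁ = x₁ ^ 3 + a₂ * x₁ ^ 2 + a₄ * x₁ + a₆)
    (h₂ : y₂ ^ 2 + a₁ * x₂ * y₂ + a₃ * y₂ = x₂ ^ 3 + a₂ * x₂ ^ 2 + a₄ * x₂ + a₆)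
    (hl : y₁ - y₂ = l * (x₁ - x₂))
    (hy' : (2 * y₁ + a₁ * x₁ + a₃) * y' = 3 * x₁ ^ 2 + 2 * a₂ * x₁ + a₄ - a₁ * y₁) :
    (y' * (x₁ - x₂) - (y₁ - y₂)) / (x₁ - x₂) ^ 2 * (2 * y₁ + a₁ * x₁ + a₃) =
      x₁ - (l ^ 2 + a₁ * l - a₂ - x₁ - x₂) := by
  have hd : x₁ - x₂ ≠ 0 := sub_ne_zero.mpr hx
  obtain rfl : y₂ = y₁ - l * (x₁ - x₂) := by linear_combination -hl
  -- The difference of the two curve equations, divided by `x₁ - x₂`.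
  have key : l * (2 * y₁ - l * (x₁ - x₂)) + a₁ * y₁ + a₁ * x₂ * l + a₃ * l =
      x₁ ^ 2 + x₁ * x₂ + x₂ ^ 2 + a₂ * (x₁ + x₂) + a₄ := by
    refine mul_left_cancel₀ hd ?_
    linear_combination h₁ - h₂
  have key2 : (y' - l) * (2 * y₁ + a₁ * x₁ + a₃) =
      (x₁ - x₂) * (x₁ - (l ^ 2 + a₁ * l - a₂ - x₁ - x₂)) := by
    linear_combination hy' - key
  rw [div_mul_eq_mul_div, div_eq_iff (pow_ne_zero 2 hd)]
  linear_combination (x₁ - x₂) * key2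

/-- The data of a local section of `xCoord` near an affine point that is not of order two,
with a primitive of the invariant differential. -/
structure LocalLog (P₀ : ComplexPoints E) where
  r : ℝ
  r_pos : 0 < r
  /-- A square root of the cubic. -/
  s : ℂ → ℂ
  /-- A primitive of the invariant differential. -/
  log : ℂ → ℂ
  log_zero : log (xCoord P₀) = 0
  s_base : s (xCoord P₀) = psi E (xCoord P₀) (yCoord P₀)
  s_sq : ∀ x ∈ Metric.ball (xCoord P₀) r, s x ^ 2 = cubic E x
  s_diff : ∀ x ∈ Metric.ball (xCoord P₀) r, DifferentiableAt ℂ s x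
  s_ne : ∀ x ∈ Metric.ball (xCoord P₀) r, s x ≠ 0
  log_deriv : ∀ x ∈ Metric.ball (xCoord P₀) r, HasDerivAt log (s x)⁻¹ x

theorem nonempty_localLog {P₀ : ComplexPoints E} (hP₀ : P₀ ≠ 0)
    (hc : cubic E (xCoord P₀) ≠ 0) : Nonempty (LocalLog P₀) := by
  have h1 := (equation_iff_psi_sq _ _).mp (equation_coord hP₀)
  have h2 : psi E (xCoord P₀) (yCoord P₀) ≠ 0 := fun h => hc (by rw [← h1, h]; ring)
  obtain ⟨r, hr, s, hs0, hs⟩ := exists_sqrt_cubic h1 h2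
  have hd : DifferentiableOn ℂ (fun x => (s x)⁻¹) (Metric.ball (xCoord P₀) r) := fun x hx =>
    ((hs x hx).2.1.inv (hs x hx).2.2).differentiableWithinAt
  obtain ⟨L, hL0, hL⟩ := hd.isExactOn_ball.with_val_at (xCoord P₀) 0
  exact ⟨⟨r, hr, s, L, hL0, hs0, fun x hx => (hs x hx).1, fun x hx => (hs x hx).2.1,
    fun x hx => (hs x hx).2.2, hL⟩⟩

namespace LocalLog

variable {P₀ : ComplexPoints E} (D : LocalLog P₀)

/-- The `y`-coordinate on the local section. -/
noncomputable def y (x : ℂ) : ℂ :=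
  (D.s x - (E.baseChange ℂ).a₁ * x - (E.baseChange ℂ).a₃) / 2

/-- The local section of `xCoord`. -/
noncomputable def point (x : ℂ) : ComplexPoints E := ofXY E x (D.y x)

theorem psi_y (x : ℂ) : psi E x (D.y x) = D.s x := by rw [psi, y]; ring

theorem y_of_psi {x y : ℂ} (h : psi E x y = D.s x) : y = D.y x := by
  rw [LocalLog.y, ← h, psi]; ring

theorem mem_ball_self : xCoord P₀ ∈ Metric.ball (xCoord P₀) D.r := Metric.mem_ball_self D.r_pos

theorem equation_y {x : ℂ} (hx : x ∈ Metric.ball (xCoord P₀) D.r) :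
    (E.baseChange ℂ).toAffine.Equation x (D.y x) := by
  rw [equation_iff_psi_sq, D.psi_y, D.s_sq x hx]

theorem differentiableAt_y {x : ℂ} (hx : x ∈ Metric.ball (xCoord P₀) D.r) :
    DifferentiableAt ℂ D.y x := by
  have := D.s_diff x hx
  unfold y
  fun_prop

theorem psi_mul_deriv_y {x : ℂ} (hx : x ∈ Metric.ball (xCoord P₀) D.r) :
    (2 * D.y x + (E.baseChange ℂ).a₁ * x + (E.baseChange ℂ).a₃) * deriv D.y x =
      3 * x ^ 2 + 2 * (E.baseChange ℂ).a₂ * x + (E.baseChange ℂ).a₄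
        - (E.baseChange ℂ).a₁ * D.y x := by
  have hy := (D.differentiableAt_y hx).hasDerivAt
  have h1 := ((hy.pow 2).add (((hasDerivAt_id x).const_mul (E.baseChange ℂ).a₁).mul hy)).add
    (hy.const_mul (E.baseChange ℂ).a₃)
  have h2 := (((hasDerivAt_pow 3 x).add ((hasDerivAt_pow 2 x).const_mul (E.baseChange ℂ).a₂)).add
    ((hasDerivAt_id x).const_mul (E.baseChange ℂ).a₄)).add_const (E.baseChange ℂ).a₆
  have h3 := h1.unique (h2.congr_of_eventuallyEq ?_)
  · simp only [Nat.cast_ofNat, id_eq, mul_one, Nat.reduceSub, pow_one] at h3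
    linear_combination h3
  · filter_upwards [Metric.isOpen_ball.mem_nhds hx] with t ht
    exact (Affine.equation_iff _ _).mp (D.equation_y ht)

/-- This is the translation invariance of the differential: if `(X, Y)` is the translate of the
point over `t`, then `dX / psi E X Y = dt / s t`. -/
theorem xCoord_add_hasDerivAt {x₂ y₂ : ℂ} (h₂ : (E.baseChange ℂ).toAffine.Nonsingular x₂ y₂)
    {t : ℂ} (ht : t ∈ Metric.ball (xCoord P₀) D.r) (hx : t ≠ x₂) [E.IsElliptic] :
    HasDerivAt (fun t => xCoord (D.point t + .some x₂ y₂ h₂))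
      (psi E (xCoord (D.point t + .some x₂ y₂ h₂)) (yCoord (D.point t + .some x₂ y₂ h₂)) / D.s t)
      t := by
  have hadd : ∀ u ∈ Metric.ball (xCoord P₀) D.r, u ≠ x₂ →
      xCoord (D.point u + .some x₂ y₂ h₂) =
        ((D.y u - y₂) / (u - x₂)) ^ 2 + (E.baseChange ℂ).a₁ * ((D.y u - y₂) / (u - x₂))
          - (E.baseChange ℂ).a₂ - u - x₂ ∧
      yCoord (D.point u + .some x₂ y₂ h₂) =
        -((D.y u - y₂) / (u - x₂) * (xCoord (D.point u + .some x₂ y₂ h₂) - u) + D.y u)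
          - (E.baseChange ℂ).a₁ * xCoord (D.point u + .some x₂ y₂ h₂) - (E.baseChange ℂ).a₃ := by
    intro u hu hux
    rw [point, ofXY_eq (D.equation_y hu), Affine.Point.add_of_X_ne hux]
    simp only [xCoord_some, yCoord_some, Affine.slope_of_X_ne hux, Affine.addX, Affine.addY,
      Affine.negAddY, Affine.negY]
    exact ⟨trivial, trivial⟩
  have hd : t - x₂ ≠ 0 := sub_ne_zero.mpr hx
  have hl := ((D.differentiableAt_y ht).hasDerivAt.sub_const y₂).div
    ((hasDerivAt_id t).sub_const x₂) hd
  have hX := ((((hl.pow 2).add (hl.const_mul (E.baseChange ℂ).a₁)).sub_const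
    (E.baseChange ℂ).a₂).sub (hasDerivAt_id t)).sub_const x₂
  have hX' := hX.congr_of_eventuallyEq (f₁ := fun t => xCoord (D.point t + .some x₂ y₂ h₂)) <| by
    filter_upwards [Metric.isOpen_ball.mem_nhds ht, isOpen_ne.mem_nhds hx] with u hu hux
    exact (hadd u hu hux).1
  refine hX'.congr_deriv ?_
  have key := slope_derivative_identity hx ((Affine.equation_iff _ _).mp (D.equation_y ht))
    ((Affine.equation_iff _ _).mp h₂.1) (div_mul_cancel₀ (D.y t - y₂) hd).symm
    (D.psi_mul_deriv_y ht)
  obtain ⟨e1, e2⟩ := hadd t ht hx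
  have e3 : psi E (xCoord (D.point t + .some x₂ y₂ h₂)) (yCoord (D.point t + .some x₂ y₂ h₂)) =
      (2 * ((D.y t - y₂) / (t - x₂)) + (E.baseChange ℂ).a₁) *
        (t - xCoord (D.point t + .some x₂ y₂ h₂)) - D.s t := by
    rw [← D.psi_y, psi, psi, e2]
    ring
  rw [eq_div_iff (D.s_ne t ht), e3, e1, ← key, ← D.psi_y t, psi]
  simp only [Nat.cast_ofNat, id_eq, mul_one, Nat.reduceSub, pow_one, Pi.div_apply]
  ring

end LocalLog

end ComplexPoints

/-! ### Additivity of the logarithm and the local isomorphism with `ℂ` -/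

namespace ComplexPoints

open WeierstrassCurve Topology Filter

variable {E : WeierstrassCurve ℝ}

namespace LocalLog

variable {P₀ : ComplexPoints E} (D : LocalLog P₀)

/-- The points on the local section of `xCoord`. -/
def OnSection (P : ComplexPoints E) : Prop :=
  P ≠ 0 ∧ xCoord P ∈ Metric.ball (xCoord P₀) D.r ∧ psi E (xCoord P) (yCoord P) = D.s (xCoord P)

/-- Over the disc `psi` is `s` or `-s`. The second is excluded near `P₀`, where `psi + s` stays
nonzero. -/
theorem eventually_onSection (hP₀ : P₀ ≠ 0) : ∀ᶠ P in 𝓝 P₀, D.OnSection P := by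
  have hx := continuousAt_xCoord hP₀
  have hy := continuousAt_yCoord hP₀
  have hs : ContinuousAt (fun P => D.s (xCoord P)) P₀ :=
    ContinuousAt.comp (g := D.s) (D.s_diff _ D.mem_ball_self).continuousAt hx
  have hsum : ContinuousAt (fun P => psi E (xCoord P) (yCoord P) + D.s (xCoord P)) P₀ := by
    unfold psi
    fun_prop
  have h0 : psi E (xCoord P₀) (yCoord P₀) + D.s (xCoord P₀) ≠ 0 := by
    rw [← D.s_base, ← two_mul]
    exact mul_ne_zero two_ne_zero (D.s_ne _ D.mem_ball_self)
  filter_upwards [isClosed_singleton_zero.isOpen_compl.mem_nhds hP₀,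
    hx.eventually_mem (Metric.isOpen_ball.mem_nhds D.mem_ball_self),
    hsum.eventually_ne h0] with P h1 h2 h3
  refine ⟨h1, h2, ?_⟩
  have h4 := (equation_iff_psi_sq _ _).mp (equation_coord h1)
  rw [← D.s_sq _ h2, sq_eq_sq_iff_eq_or_eq_neg] at h4
  exact h4.resolve_right fun h => h3 (by rw [h]; ring)

variable [E.IsElliptic]

theorem OnSection.point_xCoord {P : ComplexPoints E} {D : LocalLog P₀} (h : D.OnSection P) :
    D.point (xCoord P) = P := by
  rw [point, ← D.y_of_psi h.2.2, ofXY_coord h.1]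

theorem point_base (hP₀ : P₀ ≠ 0) : D.point (xCoord P₀) = P₀ :=
  OnSection.point_xCoord (D := D) ⟨hP₀, D.mem_ball_self, D.s_base.symm⟩

theorem point_ne_zero {x : ℂ} (hx : x ∈ Metric.ball (xCoord P₀) D.r) : D.point x ≠ 0 :=
  ofXY_ne_zero (D.equation_y hx)

theorem xCoord_point {x : ℂ} (hx : x ∈ Metric.ball (xCoord P₀) D.r) : xCoord (D.point x) = x :=
  xCoord_ofXY (D.equation_y hx)

theorem continuousAt_point {x : ℂ} (hx : x ∈ Metric.ball (xCoord P₀) D.r) :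
    ContinuousAt D.point x := by
  refine continuousAt_ofXY continuousAt_id (D.differentiableAt_y hx).continuousAt ?_
  filter_upwards [Metric.isOpen_ball.mem_nhds hx] with t ht
  exact D.equation_y ht

/-- For fixed small `S`, invariance of the differential makes `log (x (point t + S)) - log t`
constant on the disc; its value is read off at `P₀`. The radius is uniform in `S`. -/
theorem exists_log_add (hP₀ : P₀ ≠ 0) : ∃ δ > 0, δ ≤ D.r ∧ ∀ᶠ S in 𝓝 (0 : ComplexPoints E),
    ∀ t ∈ Metric.ball (xCoord P₀) δ, D.OnSection (D.point t + S) ∧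
      D.log (xCoord (D.point t + S)) = D.log t + D.log (xCoord (P₀ + S)) := by
  have hc : ContinuousAt (fun q : ℂ × ComplexPoints E => D.point q.1) (xCoord P₀, 0) :=
    ContinuousAt.comp (g := D.point) (D.continuousAt_point D.mem_ball_self) continuousAt_fst
  have hadd : Tendsto (fun q : ℂ × ComplexPoints E => D.point q.1 + q.2) (𝓝 (xCoord P₀, 0))
      (𝓝 P₀) := by
    have := Tendsto.add hc.tendsto (continuousAt_snd (p := (xCoord P₀, (0 : ComplexPoints E)))).tendsto
    simpa only [D.point_base hP₀, add_zero] using this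
  have hsub : Tendsto (fun q : ℂ × ComplexPoints E => D.point q.1 - q.2) (𝓝 (xCoord P₀, 0))
      (𝓝 P₀) := by
    have := Tendsto.sub hc.tendsto (continuousAt_snd (p := (xCoord P₀, (0 : ComplexPoints E)))).tendsto
    simpa only [D.point_base hP₀, sub_zero] using this
  have hne : ∀ᶠ P in 𝓝 P₀, P ≠ 0 := isClosed_singleton_zero.isOpen_compl.mem_nhds hP₀
  have hev := (hadd.eventually (D.eventually_onSection hP₀)).and (hsub.eventually hne)
  rw [nhds_prod_eq, eventually_prod_iff] at hev
  obtain ⟨pa, hpa, pb, hpb, hab⟩ := hev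
  obtain ⟨δ, hδ, hball⟩ := Metric.eventually_nhds_iff_ball.mp hpa
  refine ⟨min δ D.r, lt_min hδ D.r_pos, min_le_right _ _, ?_⟩
  filter_upwards [hpb] with S hS
  have hr : ∀ t ∈ Metric.ball (xCoord P₀) (min δ D.r), t ∈ Metric.ball (xCoord P₀) D.r :=
    fun t ht => Metric.ball_subset_ball (min_le_right _ _) ht
  have hgood : ∀ t ∈ Metric.ball (xCoord P₀) (min δ D.r),
      D.OnSection (D.point t + S) ∧ D.point t - S ≠ 0 :=
    fun t ht => hab (hball t (Metric.ball_subset_ball (min_le_left _ _) ht)) hS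
  have hmem := Metric.mem_ball_self (x := xCoord P₀) (lt_min hδ D.r_pos)
  intro t ht
  refine ⟨(hgood t ht).1, ?_⟩
  rcases S with _ | ⟨x₂, y₂, h₂⟩
  · change D.log (xCoord (D.point t + 0)) = D.log t + D.log (xCoord (P₀ + 0))
    rw [add_zero, add_zero, D.log_zero, add_zero, D.xCoord_point (hr t ht)]
  -- Equal abscissae would give `point u = ±S`, but both `point u + S` and `point u - S` are near
  -- `P₀`, hence nonzero.
  have hne2 : ∀ u ∈ Metric.ball (xCoord P₀) (min δ D.r), u ≠ x₂ := by
    rintro u hu rfl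
    obtain ⟨h1, h2⟩ := hgood u hu
    rcases eq_or_eq_neg_of_xCoord_eq (D.point_ne_zero (hr u hu)) (Affine.Point.some_ne_zero h₂)
      (D.xCoord_point (hr u hu)) with h | h
    · exact h2 (sub_eq_zero.mpr h)
    · exact h1.1 (add_eq_zero_iff_eq_neg.mpr h)
  have hderiv : ∀ u ∈ Metric.ball (xCoord P₀) (min δ D.r),
      HasDerivAt (fun t => D.log (xCoord (D.point t + .some x₂ y₂ h₂)) - D.log t) 0 u := by
    intro u hu
    obtain ⟨-, h2, h3⟩ := (hgood u hu).1
    have h4 := ((D.log_deriv _ h2).comp u (D.xCoord_add_hasDerivAt h₂ (hr u hu) (hne2 u hu))).sub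
      (D.log_deriv u (hr u hu))
    refine h4.congr_deriv ?_
    rw [h3, ← mul_div_assoc, inv_mul_cancel₀ (D.s_ne _ h2), one_div, sub_self]
  have hconst := Metric.isOpen_ball.is_const_of_deriv_eq_zero
    (convex_ball (xCoord P₀) (min δ D.r)).isPreconnected
    (fun u hu => (hderiv u hu).differentiableAt.differentiableWithinAt)
    (fun u hu => (hderiv u hu).deriv) ht hmem
  simp only [D.point_base hP₀, D.log_zero, sub_zero] at hconst
  rw [← hconst]
  ring

/-- The group `E(ℂ)` is locally isomorphic to `ℂ`. -/
theorem exists_local_hom (D : LocalLog P₀) (hP₀ : P₀ ≠ 0) : ∃ (e : ℂ → ComplexPoints E) (l : ComplexPoints E → ℂ),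
    Tendsto e (𝓝 0) (𝓝 0) ∧ Tendsto l (𝓝 0) (𝓝 0) ∧ (∀ᶠ v in 𝓝 0, l (e v) = v) ∧
    (∀ᶠ a in 𝓝 0, e (l a) = a) ∧
    ∀ᶠ x : ℂ × ℂ in 𝓝 (0, 0), e (x.1 + x.2) = e x.1 + e x.2 := by
  have hball := Metric.isOpen_ball.mem_nhds D.mem_ball_self
  have han : AnalyticAt ℂ D.log (xCoord P₀) := DifferentiableOn.analyticAt
    (fun x hx => (D.log_deriv x hx).differentiableAt.differentiableWithinAt) hball
  have hstrict := han.hasStrictDerivAt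
  rw [(D.log_deriv _ D.mem_ball_self).deriv] at hstrict
  have hF := hstrict.hasStrictFDerivAt_equiv (inv_ne_zero (D.s_ne _ D.mem_ball_self))
  set M := hF.localInverse D.log _ (xCoord P₀)
  have hM0 : M 0 = xCoord P₀ := by
    have := hF.localInverse_apply_image
    rwa [D.log_zero] at this
  have hMc : Tendsto M (𝓝 0) (𝓝 (xCoord P₀)) := by
    have := hF.localInverse_tendsto
    rwa [D.log_zero] at this
  have hMl : ∀ᶠ x in 𝓝 (xCoord P₀), M (D.log x) = x := hF.eventually_left_inverse
  have hlM : ∀ᶠ v in 𝓝 0, D.log (M v) = v := by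
    have := hF.eventually_right_inverse
    rwa [D.log_zero] at this
  have hpt : Tendsto D.point (𝓝 (xCoord P₀)) (𝓝 P₀) := by
    have := (D.continuousAt_point D.mem_ball_self).tendsto
    rwa [D.point_base hP₀] at this
  have hpM : Tendsto (fun v => D.point (M v)) (𝓝 0) (𝓝 P₀) := hpt.comp hMc
  have he : Tendsto (fun v => D.point (M v) - P₀) (𝓝 0) (𝓝 0) := by
    have := hpM.sub_const P₀
    rwa [sub_self] at this
  have hadd0 : Tendsto (fun R : ComplexPoints E => P₀ + R) (𝓝 0) (𝓝 P₀) := by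
    have := (continuous_const_add P₀).tendsto (0 : ComplexPoints E)
    rwa [add_zero] at this
  have hx : Tendsto xCoord (𝓝 P₀) (𝓝 (xCoord P₀)) := continuousAt_xCoord hP₀
  have hl : Tendsto (fun R : ComplexPoints E => D.log (xCoord (P₀ + R))) (𝓝 0) (𝓝 0) := by
    have h1 : Tendsto D.log (𝓝 (xCoord P₀)) (𝓝 0) := by
      have := (D.log_deriv _ D.mem_ball_self).continuousAt.tendsto
      rwa [D.log_zero] at this
    exact h1.comp (hx.comp hadd0)
  refine ⟨fun v => D.point (M v) - P₀, fun R => D.log (xCoord (P₀ + R)), he, hl, ?_, ?_, ?_⟩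
  · filter_upwards [hlM, hMc.eventually hball] with v h1 h2
    rw [add_sub_cancel, D.xCoord_point h2, h1]
  · filter_upwards [(hx.comp hadd0).eventually hMl,
      hadd0.eventually (D.eventually_onSection hP₀)] with R h1 h2
    simp only [Function.comp] at h1
    rw [h1, h2.point_xCoord, add_sub_cancel_left]
  -- Apply this with `t = M x.1` and `S = point (M x.2) - P₀`: then `P₀ + S = point (M x.2)`, and
  -- the logarithm of the sum is `x.1 + x.2`.
  · obtain ⟨δ, hδ, hδr, hlog⟩ := D.exists_log_add hP₀
    have t1 : Tendsto (fun x : ℂ × ℂ => x.1) (𝓝 (0, 0)) (𝓝 0) := continuous_fst.tendsto _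
    have t2 : Tendsto (fun x : ℂ × ℂ => x.2) (𝓝 (0, 0)) (𝓝 0) := continuous_snd.tendsto _
    have t3 : Tendsto (fun x : ℂ × ℂ => D.point (M x.1) + (D.point (M x.2) - P₀)) (𝓝 (0, 0))
        (𝓝 P₀) := by
      have := (hpM.comp t1).add (he.comp t2)
      rwa [add_zero] at this
    filter_upwards [t1.eventually hlM, t2.eventually hlM,
      (hMc.comp t1).eventually (Metric.ball_mem_nhds _ hδ),
      (hMc.comp t2).eventually hball, (he.comp t2).eventually hlog,
      (hx.comp t3).eventually hMl] with x h1 h2 h3 h4 h5 h6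
    simp only [Function.comp] at h3 h4 h5 h6
    obtain ⟨h7, h8⟩ := h5 _ h3
    rw [add_sub_cancel, D.xCoord_point h4, h1, h2] at h8
    rw [h8] at h6
    rw [h6, h7.point_xCoord]
    abel

end LocalLog

/-- The complex uniformization of an elliptic curve, up to surjectivity. -/
theorem exists_exp (E : WeierstrassCurve ℝ) [E.IsElliptic] : ∃ p : ℂ →+ ComplexPoints E,
    Continuous p ∧ IsOpenMap p ∧ IsDiscrete (p.ker : Set ℂ) := by
  obtain ⟨P₀, hP₀, -, -, hc⟩ := exists_point_avoiding (E := E) Set.finite_empty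
  obtain ⟨D⟩ := nonempty_localLog hP₀ hc
  obtain ⟨e, l, he, hl, hle, hel, hadd⟩ := D.exists_local_hom hP₀
  obtain ⟨p, hp⟩ := exists_addMonoidHom_of_local_add hadd
  exact ⟨p, addMonoidHom_local_homeo he hl hle hel hp⟩

end ComplexPoints

/-! ### Uniformization and lifts of endomorphisms -/

section Uniformization

open Topology Filter

theorem IsVectorCovering.of_isOpenMap {V : Type} [NormedAddCommGroup V] [NormedSpace ℝ V] {X : Type}
    [TopologicalSpace X] {p : V → X} {Λ : AddSubgroup V} (hc : Continuous p) (ho : IsOpenMap p)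
    (hs : Function.Surjective p) (hd : IsDiscrete (Λ : Set V))
    (heq : ∀ v w, p v = p w ↔ v - w ∈ Λ) : IsVectorCovering p Λ where
  isCoveringMap := by
    have hq : IsQuotientMap p := (IsOpenQuotientMap.mk hs hc ho).isQuotientMap
    refine (hq.isAddQuotientCoveringMap_of_addSubgroup Λ hd fun {v w} => ?_).isCoveringMap
    rw [heq, ← Λ.neg_mem_iff, neg_sub, sub_eq_add_neg]
  surjective := hs
  eq_iff := heq

/-- A continuous endomorphism lifts to a linear endomorphism of the covering vector space. -/
theorem IsVectorCovering.exists_linear_lift {V : Type} [NormedAddCommGroup V] [NormedSpace ℝ V]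
    {A : Type} [AddCommGroup A] [TopologicalSpace A] {p : V →+ A} {Λ : AddSubgroup V}
    (h : IsVectorCovering p Λ) {f : A →+ A} (hf : Continuous f) :
    ∃ T : V →L[ℝ] V, ∀ v, p (T v) = f (p v) := by
  obtain ⟨F, ⟨hF0, hF⟩, -⟩ := h.isCoveringMap.existsUnique_continuousMap_lifts
    ⟨fun v => f (p v), hf.comp h.continuous⟩ (0 : V) (0 : V) (by simp)
  have hF' : ∀ v, p (F v) = f (p v) := congrFun hF
  -- For fixed `w` both sides lift the same map of `v`, so they differ by a constant, which is zero
  -- at `v = 0`.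
  have hadd : ∀ v w, F (v + w) = F v + F w := by
    intro v w
    have := h.lift_sub_lift (F := F.comp ⟨fun v => v + w, by fun_prop⟩)
      (G := ⟨fun v => F v + F w, by fun_prop⟩) (fun v => by simp [hF']) v 0
    simpa [hF0, sub_eq_iff_eq_add] using this
  exact ⟨(AddMonoidHom.mk' F hadd).toRealLinearMap F.continuous, hF'⟩

namespace ComplexPoints

open WeierstrassCurve

variable {E : WeierstrassCurve ℝ} [E.IsElliptic]

/-! ### Connectedness -/

/-- The distances from `b` to the two roots have product `‖a - b ^ 2‖`; take the nearer root. This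
also covers `b = 0`, that is, points of order two, where no holomorphic root is available. -/
theorem exists_sqrt_near (a b : ℂ) : ∃ z : ℂ, z ^ 2 = a ∧ ‖z - b‖ ^ 2 ≤ ‖a - b ^ 2‖ := by
  obtain ⟨s, hs⟩ := IsAlgClosed.exists_pow_nat_eq a two_pos
  have h : ‖s - b‖ * ‖s + b‖ = ‖a - b ^ 2‖ := by
    rw [← norm_mul, ← hs]
    congr 1
    ring
  rcases le_total ‖s - b‖ ‖s + b‖ with h1 | h1
  · exact ⟨s, hs, by nlinarith [norm_nonneg (s - b)]⟩
  · refine ⟨-s, by rw [← hs]; ring, ?_⟩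
    rw [show -s - b = -(s + b) by ring, norm_neg]
    nlinarith [norm_nonneg (s + b)]

/-- A section of `xCoord` through `P` that is continuous at that one point suffices; the nearest
square roots provide it. -/
theorem image_xCoord_mem_nhds {U : Set (ComplexPoints E)} {P : ComplexPoints E} (hP : P ≠ 0)
    (hU : U ∈ 𝓝 P) : xCoord '' U ∈ 𝓝 (xCoord P) := by
  have h0 := (equation_iff_psi_sq _ _).mp (equation_coord hP)
  choose z hz hz' using fun x => exists_sqrt_near (cubic E x) (psi E (xCoord P) (yCoord P))
  have hzP : z (xCoord P) = psi E (xCoord P) (yCoord P) := by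
    have h := hz' (xCoord P)
    rw [h0, sub_self, norm_zero] at h
    exact sub_eq_zero.mp (norm_eq_zero.mp (pow_eq_zero_iff two_ne_zero |>.mp
      (le_antisymm h (sq_nonneg _))))
  have hzc : ContinuousAt z (xCoord P) := by
    rw [ContinuousAt, hzP, tendsto_iff_norm_sub_tendsto_zero]
    have h1 : Tendsto (fun x => ‖cubic E x - psi E (xCoord P) (yCoord P) ^ 2‖) (𝓝 (xCoord P))
        (𝓝 0) := by
      rw [h0, ← tendsto_iff_norm_sub_tendsto_zero]
      exact differentiable_cubic.continuous.tendsto _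
    have h2 := h1.sqrt
    rw [Real.sqrt_zero] at h2
    exact squeeze_zero (fun _ => norm_nonneg _) (fun x => Real.le_sqrt_of_sq_le (hz' x)) h2
  set y : ℂ → ℂ := fun x => (z x - (E.baseChange ℂ).a₁ * x - (E.baseChange ℂ).a₃) / 2
  have hpsi : ∀ x, psi E x (y x) = z x := fun x => by simp only [psi, y]; ring
  have heq : ∀ x, (E.baseChange ℂ).toAffine.Equation x (y x) := fun x => by
    rw [equation_iff_psi_sq, hpsi, hz]
  have hyP : y (xCoord P) = yCoord P := by
    have := (hpsi (xCoord P)).trans hzP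
    simp only [psi] at this
    linear_combination this / 2
  have hc : ContinuousAt (fun x => ofXY E x (y x)) (xCoord P) :=
    continuousAt_ofXY continuousAt_id (by fun_prop) (.of_forall heq)
  rw [ContinuousAt, hyP, ofXY_coord hP] at hc
  filter_upwards [hc.eventually_mem hU] with x hx
  exact ⟨_, hx, xCoord_ofXY (heq x)⟩

/-- An open subgroup is closed, so `H \ {0}` and the complement of `H` have open images under
`xCoord`, which together cover `ℂ`. These are disjoint, since `x` determines a point up to sign and
`H = -H`; connectedness of `ℂ` forbids both being nonempty. -/
theorem eq_top_of_isOpen (H : AddSubgroup (ComplexPoints E)) (hH : IsOpen (H : Set (ComplexPoints E)))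
    (hne : H ≠ ⊥) : H = ⊤ := by
  have hopen : ∀ U : Set (ComplexPoints E), IsOpen U → (0 : ComplexPoints E) ∉ U →
      IsOpen (xCoord '' U) := by
    intro U hU h0
    refine isOpen_iff_mem_nhds.mpr ?_
    rintro _ ⟨P, hP, rfl⟩
    exact image_xCoord_mem_nhds (fun h => h0 (h ▸ hP)) (hU.mem_nhds hP)
  have h1 := hopen (H \ {0}) (hH.sdiff isClosed_singleton_zero) (by simp)
  have h2 := hopen (H : Set _)ᶜ (H.isClosed_of_isOpen hH).isOpen_compl (by simp [H.zero_mem])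
  by_contra htop
  obtain ⟨P, hP, hP0⟩ := (H.bot_or_exists_ne_zero).resolve_left hne
  obtain ⟨Q, hQ⟩ : ∃ Q, Q ∉ H := by
    by_contra! h
    exact htop ((AddSubgroup.eq_top_iff' H).mpr h)
  obtain ⟨x, -, ⟨R, hR, hRx⟩, ⟨S, hS, hSx⟩⟩ := isPreconnected_univ (α := ℂ) _ _ h1 h2
    (fun x _ => by
      obtain ⟨y, hy⟩ := exists_equation (E := E) x
      by_cases h : ofXY E x y ∈ H
      · exact Or.inl ⟨_, ⟨h, ofXY_ne_zero hy⟩, xCoord_ofXY hy⟩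
      · exact Or.inr ⟨_, h, xCoord_ofXY hy⟩)
    ⟨xCoord P, trivial, P, ⟨hP, hP0⟩, rfl⟩ ⟨xCoord Q, trivial, Q, hQ, rfl⟩
  have hS0 : S ≠ 0 := fun h => hS (h ▸ H.zero_mem)
  rcases eq_or_eq_neg_of_xCoord_eq hS0 hR.2 (hSx.trans hRx.symm) with h | h
  · exact hS (h ▸ hR.1)
  · exact hS (h ▸ H.neg_mem hR.1)

/-- The complex uniformization of an elliptic curve. -/
theorem exists_uniformization (E : WeierstrassCurve ℝ) [E.IsElliptic] :
    ∃ p : ℂ →+ ComplexPoints E, IsOpenMap p ∧ IsDiscrete (p.ker : Set ℂ) ∧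
      IsVectorCovering p p.ker := by
  obtain ⟨p, hc, ho, hd⟩ := exists_exp E
  have hr : p.range = ⊤ := by
    refine eq_top_of_isOpen _ ho.isOpen_range fun h => ?_
    have hk : (p.ker : Set ℂ) = Set.univ := by
      ext v
      simpa using AddSubgroup.mem_bot.mp (h ▸ (⟨v, rfl⟩ : p v ∈ p.range))
    rw [hk, isDiscrete_univ_iff] at hd
    exact not_isOpen_singleton (0 : ℂ) (isOpen_discrete _)
  exact ⟨p, ho, hd, .of_isOpenMap hc ho (AddMonoidHom.range_eq_top.mp hr) hd fun v w => by
    rw [AddMonoidHom.mem_ker, map_sub, sub_eq_zero]⟩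

end ComplexPoints

namespace ComplexPoints

variable {E : WeierstrassCurve ℝ}

/-! ### The component of the identity in the anti-invariant points -/

section Component

variable {p : ℂ →+ ComplexPoints E} {T : ℂ →L[ℝ] ℂ} (hT : ∀ v, p (T v) = complexConj E (p v))

/-- The subspace on which a linear endomorphism acts as `-1`. -/
noncomputable abbrev antiInvariantSubspace (T : ℂ →L[ℝ] ℂ) : Submodule ℝ ℂ :=
  LinearMap.ker (T + ContinuousLinearMap.id ℝ ℂ : ℂ →L[ℝ] ℂ).toLinearMap

theorem mem_antiInvariantSubspace {v : ℂ} : v ∈ antiInvariantSubspace T ↔ T v = -v := by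
  rw [LinearMap.mem_ker, eq_neg_iff_add_eq_zero]
  rfl

include hT in
theorem apply_mem_antiInvariantPoints (v : antiInvariantSubspace T) :
    p v ∈ antiInvariantPoints E := by
  change complexConj E (p v) = -p v
  rw [← hT, mem_antiInvariantSubspace.mp v.2, map_neg]

/-- The restriction of a uniformization to the anti-invariant subspace. -/
noncomputable def antiInvariantHom : antiInvariantSubspace T →+ antiInvariantPoints E :=
  (p.comp (antiInvariantSubspace T).subtype.toAddMonoidHom).codRestrict (antiInvariantPoints E)
    (apply_mem_antiInvariantPoints hT)

theorem continuous_antiInvariantHom (hc : Continuous p) : Continuous (antiInvariantHom hT) :=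
  (hc.comp continuous_subtype_val).subtype_mk _

/-- `p v` is anti-invariant exactly when `T v + v` is a period. If `W` isolates `0` among the
periods, then requiring `T v + v ∈ W` forces `T v = -v`, so the image is the trace of an open subset
of `E(ℂ)`. -/
theorem isOpenMap_antiInvariantHom (ho : IsOpenMap p) (hd : IsDiscrete (p.ker : Set ℂ)) :
    IsOpenMap (antiInvariantHom hT) := by
  have hd' : DiscreteTopology p.ker := hd.to_subtype
  obtain ⟨W, hWo, hW⟩ := isOpen_induced_iff.mp (isOpen_discrete ({0} : Set p.ker))
  have hW0 : ∀ v ∈ p.ker, v ∈ W → v = 0 := fun v hv hvW => by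
    have : (⟨v, hv⟩ : p.ker) ∈ ({0} : Set p.ker) := hW ▸ hvW
    exact congrArg Subtype.val this
  have h0W : (0 : ℂ) ∈ W := by
    have : (0 : p.ker) ∈ Subtype.val ⁻¹' W := hW ▸ Set.mem_singleton _
    exact this
  rintro _ ⟨O, hO, rfl⟩
  refine ⟨p '' (O ∩ (fun v => T v + v) ⁻¹' W),
    ho _ (hO.inter (hWo.preimage (by fun_prop))), ?_⟩
  ext P
  constructor
  · rintro ⟨v, ⟨hvO, hvW⟩, hvP⟩
    have hker : T v + v ∈ p.ker := by
      rw [AddMonoidHom.mem_ker, map_add, hT, hvP, P.2, neg_add_cancel]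
    have hv : v ∈ antiInvariantSubspace T :=
      mem_antiInvariantSubspace.mpr (eq_neg_of_add_eq_zero_left (hW0 _ hker hvW))
    exact ⟨⟨v, hv⟩, hvO, Subtype.ext hvP⟩
  · rintro ⟨v, hvO, rfl⟩
    refine ⟨v, ⟨hvO, ?_⟩, rfl⟩
    rw [Set.mem_preimage, mem_antiInvariantSubspace.mp v.2, neg_add_cancel]
    exact h0W

variable [E.IsElliptic]

/-- The image of a vector space is connected, and as an open subgroup it is also closed. -/
theorem range_antiInvariantHom (hc : Continuous p) (ho : IsOpenMap p)
    (hd : IsDiscrete (p.ker : Set ℂ)) :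
    Set.range (antiInvariantHom hT) = connectedComponent (0 : antiInvariantPoints E) := by
  have hco := continuous_antiInvariantHom hT hc
  have hop : IsOpen ((antiInvariantHom hT).range : Set (antiInvariantPoints E)) :=
    (isOpenMap_antiInvariantHom hT ho hd).isOpen_range
  refine Set.Subset.antisymm ?_ ?_
  · exact (isPreconnected_range hco).subset_connectedComponent ⟨0, map_zero _⟩
  · have hcl : IsClopen ((antiInvariantHom hT).range : Set (antiInvariantPoints E)) :=
      ⟨AddSubgroup.isClosed_of_isOpen _ hop, hop⟩
    exact hcl.connectedComponent_subset (AddSubgroup.zero_mem _)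

theorem antiInvariantHom_mem (hc : Continuous p) (ho : IsOpenMap p)
    (hd : IsDiscrete (p.ker : Set ℂ)) (v : antiInvariantSubspace T) :
    antiInvariantHom hT v ∈ connectedComponent (0 : antiInvariantPoints E) :=
  range_antiInvariantHom hT hc ho hd ▸ Set.mem_range_self v

theorem isVectorCovering_antiInvariantComponent (hc : Continuous p) (ho : IsOpenMap p)
    (hd : IsDiscrete (p.ker : Set ℂ)) :
    IsVectorCovering (fun v => (⟨antiInvariantHom hT v, antiInvariantHom_mem hT hc ho hd v⟩ :
      AntiInvariantComponent E))
      (p.ker.comap (antiInvariantSubspace T).subtype.toAddMonoidHom) := by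
  refine .of_isOpenMap ((continuous_antiInvariantHom hT hc).subtype_mk _) ?_ ?_ ?_ ?_
  · intro U hU
    refine ⟨_, isOpenMap_antiInvariantHom hT ho hd U hU, ?_⟩
    ext P
    constructor
    · rintro ⟨v, hv, h⟩
      exact ⟨v, hv, Subtype.ext h⟩
    · rintro ⟨v, hv, rfl⟩
      exact ⟨v, hv, rfl⟩
  · rintro ⟨P, hP⟩
    rw [← range_antiInvariantHom hT hc ho hd] at hP
    obtain ⟨v, rfl⟩ := hP
    exact ⟨v, rfl⟩
  · exact hd.preimage continuous_subtype_val.continuousOn Subtype.val_injective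
  · intro v w
    rw [Subtype.mk.injEq, Subtype.ext_iff, AddSubgroup.mem_comap, AddMonoidHom.mem_ker, map_sub,
      map_sub, sub_eq_zero]
    rfl

end Component

end ComplexPoints

end Uniformization

/-- For an elliptic curve `E` over `ℝ`, the map on first homology induced by the inclusion
`E(ℂ)⁻₀ ⊆ E(ℂ)` takes values in `H₁(E(ℂ), ℤ)⁻` and is an isomorphism onto it. -/
theorem mainTheorem3 (E : WeierstrassCurve ℝ) [E.IsElliptic] :
    ∃ ψ : H1 (AntiInvariantComponent E) ≃+ H1minus E,
      ∀ c : H1 (AntiInvariantComponent E),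
        (ψ c : H1 (ComplexPoints E)) = H1map (antiInvariantComponentInclusion E) c := by
  obtain ⟨p, ho, hd, hA⟩ := ComplexPoints.exists_uniformization E
  obtain ⟨T, hT⟩ := hA.exists_linear_lift (continuous_complexConj E)
  have hB := ComplexPoints.isVectorCovering_antiInvariantComponent hT hA.continuous ho hd
  have hTker : ∀ l : p.ker, T l ∈ p.ker := fun l => by
    rw [AddMonoidHom.mem_ker, hT, AddMonoidHom.mem_ker.mp l.2, map_zero]
  -- On periods, conjugation becomes `T` and the inclusion of the component becomes the inclusion of
  -- the anti-invariant periods.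
  have hconj : ∀ l : p.ker, H1map ⟨complexConj E, continuous_complexConj E⟩ (hA.periodEquiv l) =
      hA.periodEquiv ⟨T l, hTker l⟩ := fun l =>
    hA.H1map_periodEquiv hA _ T.toLinearMap (fun v => (hT v).symm) l (hTker l)
  have hincl : ∀ l, H1map (antiInvariantComponentInclusion E) (hB.periodEquiv l) =
      hA.periodEquiv ⟨l.1, l.2⟩ := fun l =>
    hB.H1map_periodEquiv hA _ (ComplexPoints.antiInvariantSubspace T).subtype (fun v => rfl) l l.2
  have hmem : ∀ c, H1map (antiInvariantComponentInclusion E) c ∈ H1minus E := by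
    intro c
    obtain ⟨l, rfl⟩ := hB.periodEquiv.surjective c
    rw [hincl]
    change H1map _ _ = - _
    rw [hconj, ← map_neg]
    exact congrArg hA.periodEquiv (Subtype.ext (ComplexPoints.mem_antiInvariantSubspace.mp l.1.2))
  refine ⟨AddEquiv.ofBijective
    ((H1map (antiInvariantComponentInclusion E)).codRestrict (H1minus E) hmem) ⟨?_, ?_⟩,
    fun c => rfl⟩
  · refine (injective_iff_map_eq_zero _).mpr fun c hc => ?_
    obtain ⟨l, rfl⟩ := hB.periodEquiv.surjective c
    have h0 : H1map (antiInvariantComponentInclusion E) (hB.periodEquiv l) = 0 :=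
      congrArg Subtype.val hc
    rw [hincl, EmbeddingLike.map_eq_zero_iff] at h0
    have h1 : ((l.1 : ComplexPoints.antiInvariantSubspace T) : ℂ) = 0 :=
      congrArg (fun x : p.ker => (x : ℂ)) h0
    have hl : l = 0 := Subtype.ext (Subtype.ext h1)
    rw [hl, map_zero]
  · rintro ⟨c, hc⟩
    obtain ⟨l, rfl⟩ := hA.periodEquiv.surjective c
    have hl : T l = -(l : ℂ) := by
      have h1 : H1map _ _ = - _ := hc
      rw [hconj, ← map_neg] at h1
      exact congrArg Subtype.val (hA.periodEquiv.injective h1)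
    exact ⟨hB.periodEquiv ⟨⟨l, ComplexPoints.mem_antiInvariantSubspace.mpr hl⟩, l.2⟩, Subtype.ext (hincl _)⟩
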